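/- Let $\mathcal H$ be a separable complex Hilbert space (inner product linear in the second argument), let $-\infty<a<b\le\infty$, and let $V:(a,b)\to\mathcal B(\mathcal H)$ be weakly measurable with $\|V(\cdot)\|_{\mathcal B(\mathcal H)}\in L^1_{\rm loc}((a,b))$ and $V(x)=V(x)^*$ for a.e. $x$. Put $\tau=-\frac{d^2}{dx^2}+V(\cdot)$, and let $H_{\max}u=\tau u$ be the maximal operator in $L^2((a,b);dx;\mathcal H)$, with domain all $u\in L^2((a,b);dx;\mathcal H)\cap W^{2,1}_{\rm loc}((a,b);dx;\mathcal H)$ such that $\tau u\in L^2((a,b);dx;\mathcal H)$. Assume that $a$ is a regular endpoint, that is, $\|V(\cdot)\|\in L^1((a,c))$ for some $c\in(a,b)$, and that $b$ is of limit-point type, that is, $\lim_{x\uparrow b}\big[(u(x),v'(x))_{\mathcal H}-(u'(x),v(x))_{\mathcal H}\big]=0$ for all $u,v\in\operatorname{dom}(H_{\max})$. Let $\alpha\in\mathcal B(\mathcal H)$ be self-adjoint. For $z\in\mathbb C\setminus\mathbb R$ let $\theta_\alpha(z,\cdot,a)$, $\phi_\alpha(z,\cdot,a)$ be the $\mathcal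 B(\mathcal H)$-valued solutions of $\tau Y=zY$ on $[a,b)$ (meaning that, for every $h\in\mathcal H$, $Y(\cdot)h\in W^{2,1}_{\rm loc}([a,b);dx;\mathcal H)$ and $-Y''h+VYh=zYh$ a.e.) with $$\theta_\alpha(z,a,a)=\phi_\alpha'(z,a,a)=\cos(\alpha),\qquad -\phi_\alpha(z,a,a)=\theta_\alpha'(z,a,a)=\sin(\alpha),$$ and let $\mathcal D_z=\{u\in\operatorname{dom}(H_{\max}) : H_{\max}u=zu\}$. Every $u\in\mathcal D_z$ has boundary values $u(a)$, $u'(a)$ (limits as $x\downarrow a$) and equals $\theta_\alpha(z,\cdot,a)f+\phi_\alpha(z,\cdot,a)g$ with $$f=\mathcal C_{1,\alpha,z}u:=\cos(\alpha)u(a)+\sin(\alpha)u'(a),\qquad g=\mathcal C_{2,\alpha,z}u:=-\sin(\alpha)u(a)+\cos(\alpha)u'(a).$$ The map $\mathcal C_{1,\alpha,z}:\mathcal D_z\to\mathcal H$ is a bijection, so that $$m_\alpha(z)=\mathcal C_{2,\alpha,z}\,\mathcal C_{1,\alpha,z}^{-1}:\mathcal H\to\mathcal H,\qquad z\in\mathbb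 C\setminus\mathbb R,$$ is well defined. Moreover: 1. $m_\alpha(z)\in\mathcal B(\mathcal H)$ for all $z\in\mathbb C\setminus\mathbb R$, and $m_\alpha(\cdot)$ is analytic on $\mathbb C\setminus\mathbb R$ (as a $\mathcal B(\mathcal H)$-valued function, in operator norm). 2. $m_\alpha(z)=m_\alpha(\overline z)^*$ for all $z\in\mathbb C\setminus\mathbb R$. 3. The Weyl–Titchmarsh solution $\psi_\alpha(z,x)=\theta_\alpha(z,x,a)+\phi_\alpha(z,x,a)m_\alpha(z)$ is square integrable: $\int_a^b\|\psi_\alpha(z,x)h\|_{\mathcal H}^2\,dx<\infty$ for all $h\in\mathcal H$ and $z\in\mathbb C\setminus\mathbb R$. -/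

import Mathlib

open MeasureTheory Filter Topology Set

namespace WeylTitchmarsh

noncomputable section

variable {H : Type*} [NormedAddCommGroup H] [InnerProductSpace ℂ H]

/-- The open interval `(a, b)`, with `a` finite and `b ≤ ∞`, as a set of reals. -/
def openInterval (a : ℝ) (b : EReal) : Set ℝ := {x | a < x ∧ (x : EReal) < b}

/-- The half-open interval `[a, b)`, with `a` finite and `b ≤ ∞`, as a set of reals. -/
def halfOpenInterval (a : ℝ) (b : EReal) : Set ℝ := {x | a ≤ x ∧ (x : EReal) < b}

/-- Lebesgue measure on `(a, b)`. -/
def intervalMeasure (a : ℝ) (b : EReal) : Measure ℝ := volume.restrict (openInterval a b)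

/-- The filter `x ↑ b` (with `b = ∞` allowed). -/
def leftOf (b : EReal) : Filter ℝ := comap (fun x : ℝ => (x : EReal)) (𝓝[<] b)

/-- The Hilbert space `L²((a, b); dx; H)`. -/
abbrev L2 (H : Type*) [NormedAddCommGroup H] [InnerProductSpace ℂ H] (a : ℝ) (b : EReal) :=
  Lp H 2 (intervalMeasure a b)

/-- `y` is (the continuously differentiable representative of) an element of `W^{2,1}_loc(I; H)`
on an interval `I`, with strong derivatives `y' = y₁` and `y'' = y₂`: both are integrable over
compact subintervals of `I`, and `y`, `y₁` are the integrals of `y₁`, `y₂`. -/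
structure IsW21Loc (I : Set ℝ) (y y₁ y₂ : ℝ → H) : Prop where
  integrable₁ : ∀ c ∈ I, ∀ d ∈ I, IntervalIntegrable y₁ volume c d
  integrable₂ : ∀ c ∈ I, ∀ d ∈ I, IntervalIntegrable y₂ volume c d
  sub_eq : ∀ c ∈ I, ∀ d ∈ I, y d - y c = ∫ t in c..d, y₁ t
  deriv_sub_eq : ∀ c ∈ I, ∀ d ∈ I, y₁ d - y₁ c = ∫ t in c..d, y₂ t

lemma IsW21Loc.zero (I : Set ℝ) : IsW21Loc I (0 : ℝ → H) 0 0 where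
  integrable₁ _ _ _ _ := intervalIntegrable_const
  integrable₂ _ _ _ _ := intervalIntegrable_const
  sub_eq _ _ _ _ := by simp
  deriv_sub_eq _ _ _ _ := by simp

lemma IsW21Loc.add {I : Set ℝ} {y y₁ y₂ v v₁ v₂ : ℝ → H} (hy : IsW21Loc I y y₁ y₂)
    (hv : IsW21Loc I v v₁ v₂) : IsW21Loc I (y + v) (y₁ + v₁) (y₂ + v₂) where
  integrable₁ c hc d hd := (hy.integrable₁ c hc d hd).add (hv.integrable₁ c hc d hd)
  integrable₂ c hc d hd := (hy.integrable₂ c hc d hd).add (hv.integrable₂ c hc d hd)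
  sub_eq c hc d hd := by
    simp only [Pi.add_apply]
    rw [intervalIntegral.integral_add (hy.integrable₁ c hc d hd) (hv.integrable₁ c hc d hd),
      ← hy.sub_eq c hc d hd, ← hv.sub_eq c hc d hd]
    abel
  deriv_sub_eq c hc d hd := by
    simp only [Pi.add_apply]
    rw [intervalIntegral.integral_add (hy.integrable₂ c hc d hd) (hv.integrable₂ c hc d hd),
      ← hy.deriv_sub_eq c hc d hd, ← hv.deriv_sub_eq c hc d hd]
    abel

lemma IsW21Loc.smul {I : Set ℝ} {y y₁ y₂ : ℝ → H} (hy : IsW21Loc I y y₁ y₂) (k : ℂ) :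
    IsW21Loc I (k • y) (k • y₁) (k • y₂) where
  integrable₁ c hc d hd := (hy.integrable₁ c hc d hd).smul k
  integrable₂ c hc d hd := (hy.integrable₂ c hc d hd).smul k
  sub_eq c hc d hd := by
    simp only [Pi.smul_apply]
    rw [intervalIntegral.integral_smul, ← hy.sub_eq c hc d hd, smul_sub]
  deriv_sub_eq c hc d hd := by
    simp only [Pi.smul_apply]
    rw [intervalIntegral.integral_smul, ← hy.deriv_sub_eq c hc d hd, smul_sub]

variable [CompleteSpace H]

/-- `V : (a, b) → B(H)` is weakly measurable, `‖V‖` is locally integrable on `(a, b)`, and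
`V` is self-adjoint almost everywhere on `(a, b)`. -/
structure IsPotential (a : ℝ) (b : EReal) (V : ℝ → H →L[ℂ] H) : Prop where
  weaklyMeasurable : ∀ f g : H, AEMeasurable (fun x => inner ℂ f (V x g)) (intervalMeasure a b)
  locallyIntegrable : LocallyIntegrableOn (fun x => ‖V x‖) (openInterval a b) volume
  selfAdjoint : ∀ᵐ x ∂(intervalMeasure a b), IsSelfAdjoint (V x)

/-- The (finite) left endpoint `a` is regular: `‖V‖` is integrable up to `a`. -/
def IsRegularLeft (a : ℝ) (b : EReal) (V : ℝ → H →L[ℂ] H) : Prop :=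
  ∃ c ∈ openInterval a b, IntegrableOn (fun x => ‖V x‖) (Icc a c) volume

/-- `u ∈ dom(H_max)` and `H_max u = w`, where `y` is the continuously differentiable representative
of `u` and `y₁ = y'`: that is, `u, w ∈ L²`, `y ∈ W^{2,1}_loc((a, b); H)` and `w = -y'' + V y`. -/
def IsMaxRep (a : ℝ) (b : EReal) (V : ℝ → H →L[ℂ] H) (u w : L2 H a b) (y y₁ : ℝ → H) : Prop :=
  ∃ y₂ : ℝ → H, IsW21Loc (openInterval a b) y y₁ y₂ ∧ u =ᵐ[intervalMeasure a b] y ∧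
    w =ᵐ[intervalMeasure a b] fun x => -y₂ x + V x (y x)

/-- The graph `{(u, H_max u) | u ∈ dom(H_max)}` of the maximal operator of `-d²/dx² + V`
in `L²((a, b); dx; H)`. -/
def maxGraph (a : ℝ) (b : EReal) (V : ℝ → H →L[ℂ] H) : Submodule ℂ (L2 H a b × L2 H a b) where
  carrier := {p | ∃ y y₁ : ℝ → H, IsMaxRep a b V p.1 p.2 y y₁}
  zero_mem' := by
    refine ⟨0, 0, 0, IsW21Loc.zero _, Lp.coeFn_zero _ _ _, ?_⟩
    filter_upwards [Lp.coeFn_zero H 2 (intervalMeasure a b)] with x hx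
    simpa using hx
  add_mem' := by
    rintro ⟨u, w⟩ ⟨u', w'⟩ ⟨y, y₁, y₂, hy, hu, hw⟩ ⟨v, v₁, v₂, hv, hu', hw'⟩
    refine ⟨y + v, y₁ + v₁, y₂ + v₂, hy.add hv, ?_, ?_⟩
    · exact (Lp.coeFn_add u u').trans (hu.add hu')
    · filter_upwards [Lp.coeFn_add w w', hw, hw'] with x h h1 h2
      simp only [Prod.mk_add_mk, h, Pi.add_apply, h1, h2, map_add]
      abel
  smul_mem' := by
    rintro k ⟨u, w⟩ ⟨y, y₁, y₂, hy, hu, hw⟩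
    refine ⟨k • y, k • y₁, k • y₂, hy.smul k, ?_, ?_⟩
    · exact (Lp.coeFn_smul k u).trans (hu.const_smul k)
    · filter_upwards [Lp.coeFn_smul k w, hw] with x h h1
      simp only [Prod.smul_mk, h, Pi.smul_apply, h1, map_smul, smul_add, smul_neg]

/-- The right endpoint `b` is of limit-point type: the Wronskian
`W_*(u, v)(x) = (u(x), v'(x)) - (u'(x), v(x))` tends to `0` as `x ↑ b` for all
`u, v ∈ dom(H_max)`. -/
def IsLimitPointRight (a : ℝ) (b : EReal) (V : ℝ → H →L[ℂ] H) : Prop :=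
  ∀ (u w u' w' : L2 H a b) (y y₁ v v₁ : ℝ → H),
    IsMaxRep a b V u w y y₁ → IsMaxRep a b V u' w' v v₁ →
      Tendsto (fun x => inner ℂ (y x) (v₁ x) - inner ℂ (y₁ x) (v x)) (leftOf b) (𝓝 0)

/-- The space `D_z = {u ∈ dom(H_max) | H_max u = z u}`. -/
def deficiencySpace (a : ℝ) (b : EReal) (V : ℝ → H →L[ℂ] H) (z : ℂ) : Submodule ℂ (L2 H a b) :=
  (maxGraph a b V).comap (LinearMap.id.prod (z • LinearMap.id))

/-- `u ∈ dom(H_max)` has the boundary data `u(a) = p.1`, `u'(a) = p.2`, as limits `x ↓ a`. -/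
def HasBoundaryData (a : ℝ) (b : EReal) (V : ℝ → H →L[ℂ] H) (u : L2 H a b) (p : H × H) : Prop :=
  ∃ (w : L2 H a b) (y y₁ : ℝ → H), IsMaxRep a b V u w y y₁ ∧
    Tendsto y (𝓝[>] a) (𝓝 p.1) ∧ Tendsto y₁ (𝓝[>] a) (𝓝 p.2)

/-- The boundary data `(u(a), u'(a))` of `u ∈ dom(H_max)`. -/
def boundaryData (a : ℝ) (b : EReal) (V : ℝ → H →L[ℂ] H) (u : L2 H a b) : H × H :=
  Classical.epsilon (HasBoundaryData a b V u)

/-- `sin(α)` for a self-adjoint `α ∈ B(H)`. -/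
def sinOp (α : H →L[ℂ] H) : H →L[ℂ] H := cfc Real.sin α

/-- `cos(α)` for a self-adjoint `α ∈ B(H)`. -/
def cosOp (α : H →L[ℂ] H) : H →L[ℂ] H := cfc Real.cos α

/-- `Y : [a, b) → B(H)` solves `-Y'' + V Y = z Y`, `Y(a) = A`, `Y'(a) = B`: for every `h`,
`Y(·) h` lies in `W^{2,1}_loc([a, b); H)` and satisfies the equation almost everywhere. -/
def IsOperatorSolution (a : ℝ) (b : EReal) (V : ℝ → H →L[ℂ] H) (z : ℂ) (A B : H →L[ℂ] H)
    (Y : ℝ → H →L[ℂ] H) : Prop :=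
  ∀ h : H, ∃ y₁ y₂ : ℝ → H, IsW21Loc (halfOpenInterval a b) (fun x => Y x h) y₁ y₂ ∧
    (∀ᵐ x ∂(intervalMeasure a b), -y₂ x + V x (Y x h) = z • Y x h) ∧ Y a h = A h ∧ y₁ a = B h

/-- `θ_α(z, ·, a)`: the solution with `θ(a) = cos(α)`, `θ'(a) = sin(α)`. -/
def theta (a : ℝ) (b : EReal) (V : ℝ → H →L[ℂ] H) (α : H →L[ℂ] H) (z : ℂ) : ℝ → H →L[ℂ] H :=
  Classical.epsilon (IsOperatorSolution a b V z (cosOp α) (sinOp α))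

/-- `φ_α(z, ·, a)`: the solution with `φ(a) = -sin(α)`, `φ'(a) = cos(α)`. -/
def phi (a : ℝ) (b : EReal) (V : ℝ → H →L[ℂ] H) (α : H →L[ℂ] H) (z : ℂ) : ℝ → H →L[ℂ] H :=
  Classical.epsilon (IsOperatorSolution a b V z (-sinOp α) (cosOp α))

/-- `C_{1,α,z} : D_z → H`, `u ↦ cos(α) u(a) + sin(α) u'(a)`. -/
def boundaryMap₁ (a : ℝ) (b : EReal) (V : ℝ → H →L[ℂ] H) (α : H →L[ℂ] H) (z : ℂ)
    (u : deficiencySpace a b V z) : H :=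
  cosOp α (boundaryData a b V u).1 + sinOp α (boundaryData a b V u).2

/-- `C_{2,α,z} : D_z → H`, `u ↦ -sin(α) u(a) + cos(α) u'(a)`. -/
def boundaryMap₂ (a : ℝ) (b : EReal) (V : ℝ → H →L[ℂ] H) (α : H →L[ℂ] H) (z : ℂ)
    (u : deficiencySpace a b V z) : H :=
  -sinOp α (boundaryData a b V u).1 + cosOp α (boundaryData a b V u).2

/-- The Weyl–Titchmarsh function `m_α(z) = C_{2,α,z} ∘ C_{1,α,z}⁻¹`, as a map `H → H`. -/
def weylM (a : ℝ) (b : EReal) (V : ℝ → H →L[ℂ] H) (α : H →L[ℂ] H) (z : ℂ) (h : H) : H :=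
  boundaryMap₂ a b V α z (Function.invFun (boundaryMap₁ a b V α z) h)

/-- The Weyl–Titchmarsh solution `ψ_α(z, x) = θ_α(z, x, a) + φ_α(z, x, a) m_α(z)`. -/
def weylSolution (a : ℝ) (b : EReal) (V : ℝ → H →L[ℂ] H) (α : H →L[ℂ] H) (z : ℂ) (x : ℝ)
    (h : H) : H :=
  theta a b V α z x h + phi a b V α z x (weylM a b V α z h)

end

end WeylTitchmarsh

/-!
The Weyl–Titchmarsh function is obtained as the Weyl function of a boundary triple.

Let `T` be the maximal operator of `τ = -d²/dx² + V`, and attach to `u` in its domain the boundary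
values `f = cos α u(a) + sin α u'(a)` and `g = -sin α u(a) + cos α u'(a)`. Since `cos² α + sin² α = 1`
and `b` is limit point, Green's identity reads `(Tu, u') - (u, Tu') = (g, f') - (f, g')`
(`boundaryTriple_green`). Two more facts about `T` are used:

* Boundary values `(h, 0)` are attained by `E h`, bounded in `h` together with `F h = T (E h)`: a
  solution of `τ y = 0`, cut off smoothly near `a` (`exists_lift`). The potential enters the product
  rule only through `τ y = 0`, so no local square integrability of `V` is needed.
* The restriction of `T` to `f = 0` contains its adjoint (`boundaryTriple_maximal`). If `(g, k)` lies
  in the adjoint, let `p` solve `τ p = k` with boundary values `(0, h)`, where `h` is determined by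
  pairing with the lift. On `(a, d)` one tests with the solution `u` of `τ u = g - p` with zero data
  at `d`, corrected by the lift of its first boundary value, and Green's identity on `[a, d]` turns
  this into `∫_a^d ‖g - p‖² = 0`. No density argument for a minimal operator is involved.

The rest is Hilbert space theory (`IsBoundaryTriple.exists_weylFunction`): the restriction `A` of `T`
to `f = 0` is self-adjoint, so that its resolvent `R(z)` exists and is analytic off the real axis, and
`u = E h - R(z) (F - z E) h` is the unique `u` with `T u = z u` and first boundary value `h`. Its second
boundary value is `M(z) h = ((F* - z E*) R(z) (F - z E) - E* (F - z E)) h`, which gives boundedness and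
analyticity; `M(z) = M(z̄)*` is Green's identity for the solutions at `z` and `z̄`.

The analytic input is the linear initial value problem with a locally integrable operator
coefficient, solved by the Picard series with the bound `|L|ⁿ / n!`, where `L` is a primitive of the
bound for the coefficient (`IsLinearCoeff.exists_solution`, `IsLinearCoeff.eq_zero`), and the Leibniz
rule for vector-valued absolutely continuous functions (`IsPrimitiveOn.bilin`).
-/

namespace WeylTitchmarsh

/-! ### Locally absolutely continuous functions with values in a Banach space -/

section Primitive

variable {E F G : Type*} [NormedAddCommGroup E] [NormedSpace ℝ E] [NormedAddCommGroup F]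
  [NormedSpace ℝ F] [NormedAddCommGroup G] [NormedSpace ℝ G] {I : Set ℝ}

/-- `Y` is a primitive on `I` of the locally integrable function `f`: local integrability means
integrability over compact subintervals with end points in `I`, so that an end point of an
interval `I` is included exactly when it belongs to `I`. -/
structure IsPrimitiveOn (I : Set ℝ) (Y f : ℝ → E) : Prop where
  integrable : ∀ c ∈ I, ∀ d ∈ I, IntervalIntegrable f volume c d
  sub_eq : ∀ c ∈ I, ∀ d ∈ I, Y d - Y c = ∫ t in c..d, f t

lemma IsPrimitiveOn.mono {J : Set ℝ} {Y f : ℝ → E} (h : IsPrimitiveOn I Y f) (hJ : J ⊆ I) :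
    IsPrimitiveOn J Y f where
  integrable c hc d hd := h.integrable c (hJ hc) d (hJ hd)
  sub_eq c hc d hd := h.sub_eq c (hJ hc) d (hJ hd)

lemma isPrimitiveOn_of_base {Y f : ℝ → E} {c : ℝ}
    (hf : ∀ x ∈ I, IntervalIntegrable f volume c x)
    (h : ∀ x ∈ I, Y x = Y c + ∫ t in c..x, f t) : IsPrimitiveOn I Y f where
  integrable x hx y hy := (hf x hx).symm.trans (hf y hy)
  sub_eq x hx y hy := by
    rw [h x hx, h y hy, ← intervalIntegral.integral_add_adjacent_intervals (hf x hx).symm (hf y hy),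
      intervalIntegral.integral_symm c x]
    abel

lemma IsPrimitiveOn.congr [I.OrdConnected] {Y Z f g : ℝ → E} (h : IsPrimitiveOn I Y f)
    (hY : ∀ x ∈ I, Z x = Y x) (hf : ∀ᵐ x, x ∈ I → f x = g x) : IsPrimitiveOn I Z g := by
  have key : ∀ c ∈ I, ∀ d ∈ I, ∀ᵐ x, x ∈ uIoc c d → f x = g x := by
    intro c hc d hd
    filter_upwards [hf] with x hx hx'
    exact hx ((‹I.OrdConnected›.uIcc_subset hc hd) (uIoc_subset_uIcc hx'))
  refine ⟨fun c hc d hd => (h.integrable c hc d hd).congr_ae ?_, fun c hc d hd => ?_⟩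
  · exact (ae_restrict_iff' measurableSet_uIoc).2 (key c hc d hd)
  · rw [hY c hc, hY d hd, h.sub_eq c hc d hd]
    exact intervalIntegral.integral_congr_ae (key c hc d hd)

lemma IsPrimitiveOn.continuousOn [I.OrdConnected] {Y f : ℝ → E} (h : IsPrimitiveOn I Y f) {c d : ℝ}
    (hc : c ∈ I) (hd : d ∈ I) : ContinuousOn Y (uIcc c d) := by
  have h1 := intervalIntegral.continuousOn_primitive_interval' (h.integrable c hc d hd) left_mem_uIcc
  refine (h1.const_add (Y c)).congr fun x hx => ?_
  simp [← h.sub_eq c hc x (‹I.OrdConnected›.uIcc_subset hc hd hx)]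

lemma IsPrimitiveOn.add {Y f Z g : ℝ → E} (h : IsPrimitiveOn I Y f) (h' : IsPrimitiveOn I Z g) :
    IsPrimitiveOn I (fun x => Y x + Z x) (fun x => f x + g x) where
  integrable c hc d hd := (h.integrable c hc d hd).add (h'.integrable c hc d hd)
  sub_eq c hc d hd := by
    rw [intervalIntegral.integral_add (h.integrable c hc d hd) (h'.integrable c hc d hd),
      ← h.sub_eq c hc d hd, ← h'.sub_eq c hc d hd]
    abel

/-- The fundamental theorem of calculus for a vector-valued function whose increments are
dominated by those of an absolutely continuous real function. -/
lemma integral_eq_sub_of_ae_hasDerivAt [CompleteSpace E] {G g : ℝ → E} {κ : ℝ → ℝ} {c d C : ℝ}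
    (hκ0 : ∀ t, 0 ≤ κ t) (hκ : IntervalIntegrable κ volume c d)
    (hG : ∀ x ∈ uIcc c d, ∀ y ∈ uIcc c d, ‖G y - G x‖ ≤ C * |∫ t in x..y, κ t|)
    (hg : IntervalIntegrable g volume c d)
    (hd : ∀ᵐ x, x ∈ uIcc c d → HasDerivAt G (g x) x) :
    ∫ t in c..d, g t = G d - G c := by
  -- `K` dominates the increments of the difference `D` below, which is thus absolutely continuous
  -- with zero derivative almost everywhere
  set K : ℝ → ℝ := fun x => ∫ t in c..x, (C * κ t + ‖g t‖)
  have hint : IntervalIntegrable (fun t => C * κ t + ‖g t‖) volume c d :=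
    (hκ.const_mul C).add hg.norm
  have hK : AbsolutelyContinuousOnInterval K c d :=
    hint.absolutelyContinuousOnInterval_intervalIntegral left_mem_uIcc
  have sub : ∀ x ∈ uIcc c d, ∀ y ∈ uIcc c d, uIcc x y ⊆ uIcc c d := fun x hx y hy =>
    uIcc_subset_uIcc hx hy
  set D : ℝ → E := fun x => G x - ∫ t in c..x, g t
  have hD : ∀ x ∈ uIcc c d, ∀ y ∈ uIcc c d, dist (D x) (D y) ≤ dist (K x) (K y) := by
    intro x hx y hy
    have i1 : ∀ w ∈ uIcc c d, IntervalIntegrable g volume c w := fun w hw =>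
      hg.mono_set (sub c left_mem_uIcc w hw)
    have i2 : ∀ w ∈ uIcc c d, IntervalIntegrable (fun t => C * κ t + ‖g t‖) volume c w :=
      fun w hw => hint.mono_set (sub c left_mem_uIcc w hw)
    have j1 := hκ.mono_set (sub x hx y hy)
    have j2 := hg.mono_set (sub x hx y hy)
    have e1 : D y - D x = (G y - G x) - ∫ t in x..y, g t := by
      rw [← intervalIntegral.integral_interval_sub_left (i1 y hy) (i1 x hx)]
      simp only [D]; abel
    have e2 : K y - K x = C * (∫ t in x..y, κ t) + ∫ t in x..y, ‖g t‖ := by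
      simp only [K]
      rw [intervalIntegral.integral_interval_sub_left (i2 y hy) (i2 x hx),
        intervalIntegral.integral_add (j1.const_mul C) j2.norm,
        intervalIntegral.integral_const_mul]
    rw [dist_comm, dist_eq_norm, dist_comm (K x), Real.dist_eq, e1, e2]
    have b1 : ‖G y - G x‖ ≤ C * |∫ t in x..y, κ t| := hG x hx y hy
    have b2 : ‖∫ t in x..y, g t‖ ≤ |∫ t in x..y, ‖g t‖| :=
      intervalIntegral.norm_integral_le_abs_integral_norm
    refine (norm_sub_le _ _).trans ((add_le_add b1 b2).trans ?_)
    rcases le_total x y with hxy | hxy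
    · have p1 : 0 ≤ ∫ t in x..y, κ t := intervalIntegral.integral_nonneg hxy fun _ _ => hκ0 _
      have p2 : 0 ≤ ∫ t in x..y, ‖g t‖ := intervalIntegral.integral_nonneg hxy fun _ _ => norm_nonneg _
      rw [abs_of_nonneg p1, abs_of_nonneg p2]
      exact le_abs_self _
    · have p1 : 0 ≤ ∫ t in y..x, κ t := intervalIntegral.integral_nonneg hxy fun _ _ => hκ0 _
      have p2 : 0 ≤ ∫ t in y..x, ‖g t‖ := intervalIntegral.integral_nonneg hxy fun _ _ => norm_nonneg _
      rw [intervalIntegral.integral_symm y x, intervalIntegral.integral_symm y x, abs_neg, abs_neg,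
        abs_of_nonneg p1, abs_of_nonneg p2]
      refine le_trans (le_of_eq ?_) (neg_le_abs _)
      ring
  have hDac : AbsolutelyContinuousOnInterval D c d := by
    rw [absolutelyContinuousOnInterval_iff] at hK ⊢
    intro ε hε
    obtain ⟨δ, hδ, h⟩ := hK ε hε
    refine ⟨δ, hδ, fun P hP hlt => lt_of_le_of_lt (Finset.sum_le_sum fun i hi => ?_) (h P hP hlt)⟩
    have := hP.1 i hi
    exact hD _ this.1 _ this.2
  have hD0 : ∀ᵐ x, x ∈ uIcc c d → HasDerivAt D 0 x := by
    filter_upwards [hd, hg.ae_hasDerivAt_integral] with x h1 h2 hx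
    simpa using! (h1 hx).sub (h2 hx c left_mem_uIcc)
  obtain ⟨k, hk⟩ := hDac.const_of_ae_hasDerivAt_zero hD0
  have h1 := hk c left_mem_uIcc
  have h2 := hk d right_mem_uIcc
  simp only [D, intervalIntegral.integral_same, sub_zero] at h1 h2
  rw [h1, ← h2]; abel

lemma intervalIntegrable_bilin {B : E × F → G} (hB : IsBoundedBilinearMap ℝ B) {Y : ℝ → E}
    {g : ℝ → F} {c d : ℝ} (hY : ContinuousOn Y (uIcc c d)) (hg : IntervalIntegrable g volume c d) :
    IntervalIntegrable (fun t => B (Y t, g t)) volume c d := by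
  obtain ⟨C, hC, hb⟩ := hB.bound
  obtain ⟨M, hM⟩ := isCompact_uIcc.exists_bound_of_continuousOn hY
  rw [intervalIntegrable_iff] at hg ⊢
  refine Integrable.mono' (hg.norm.const_mul (C * M)) ?_ ?_
  · refine hB.continuous.comp_aestronglyMeasurable (AEStronglyMeasurable.prodMk ?_ hg.1)
    exact (hY.mono uIoc_subset_uIcc).aestronglyMeasurable measurableSet_uIoc
  · refine (ae_restrict_iff' measurableSet_uIoc).2 (ae_of_all _ fun t ht => ?_)
    refine (hb _ _).trans ?_
    have := hM t (uIoc_subset_uIcc ht)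
    gcongr

lemma isBoundedBilinearMap_swap {B : E × F → G} (hB : IsBoundedBilinearMap ℝ B) :
    IsBoundedBilinearMap ℝ (fun p : F × E => B (p.2, p.1)) where
  add_left x y z := hB.add_right z x y
  smul_left k x y := hB.smul_right k y x
  add_right x y z := hB.add_left y z x
  smul_right k x y := hB.smul_left k y x
  bound := by
    obtain ⟨C, hC, hb⟩ := hB.bound
    exact ⟨C, hC, fun x y => (hb y x).trans (le_of_eq (by ring))⟩

/-- The Leibniz rule for locally absolutely continuous functions. -/
lemma IsPrimitiveOn.bilin [I.OrdConnected] [CompleteSpace E] [CompleteSpace F] [CompleteSpace G]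
    {B : E × F → G} (hB : IsBoundedBilinearMap ℝ B)
    {Y f : ℝ → E} {Z g : ℝ → F} (hY : IsPrimitiveOn I Y f) (hZ : IsPrimitiveOn I Z g) :
    IsPrimitiveOn I (fun x => B (Y x, Z x)) (fun x => B (Y x, g x) + B (f x, Z x)) := by
  have hint : ∀ c ∈ I, ∀ d ∈ I, IntervalIntegrable (fun x => B (Y x, g x) + B (f x, Z x))
      volume c d := fun c hc d hd =>
    (intervalIntegrable_bilin hB (hY.continuousOn hc hd) (hZ.integrable c hc d hd)).add
      (intervalIntegrable_bilin (isBoundedBilinearMap_swap hB) (hZ.continuousOn hc hd)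
        (hY.integrable c hc d hd))
  refine ⟨hint, fun c hc d hd => ?_⟩
  obtain ⟨C, hC, hb⟩ := hB.bound
  obtain ⟨M, hM⟩ := isCompact_uIcc.exists_bound_of_continuousOn (hY.continuousOn hc hd)
  obtain ⟨N, hN⟩ := isCompact_uIcc.exists_bound_of_continuousOn (hZ.continuousOn hc hd)
  have hsub : uIcc c d ⊆ I := ‹I.OrdConnected›.uIcc_subset hc hd
  refine (integral_eq_sub_of_ae_hasDerivAt (G := fun x => B (Y x, Z x))
    (κ := fun t => ‖f t‖ + ‖g t‖) (C := C * (|M| + |N|)) (fun t => by positivity)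
    ((hY.integrable c hc d hd).norm.add (hZ.integrable c hc d hd).norm) ?_ (hint c hc d hd) ?_).symm
  · intro x hx y hy
    have e : B (Y y, Z y) - B (Y x, Z x) = B (Y y, Z y - Z x) + B (Y y - Y x, Z x) := by
      rw [hB.map_sub_left, hB.map_sub_right]; abel
    have i1 := hY.integrable x (hsub hx) y (hsub hy)
    have i2 := hZ.integrable x (hsub hx) y (hsub hy)
    have hsum : |∫ t in x..y, ‖f t‖ + ‖g t‖| = |∫ t in x..y, ‖f t‖| + |∫ t in x..y, ‖g t‖| := by
      rw [intervalIntegral.integral_add i1.norm i2.norm]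
      rcases le_total x y with hxy | hxy
      · exact (abs_add_eq_add_abs_iff _ _).2 (Or.inl
          ⟨intervalIntegral.integral_nonneg hxy fun _ _ => norm_nonneg _,
            intervalIntegral.integral_nonneg hxy fun _ _ => norm_nonneg _⟩)
      · rw [intervalIntegral.integral_symm y x, intervalIntegral.integral_symm y x, ← neg_add,
          abs_neg, abs_neg, abs_neg]
        exact (abs_add_eq_add_abs_iff _ _).2 (Or.inl
          ⟨intervalIntegral.integral_nonneg hxy fun _ _ => norm_nonneg _,
            intervalIntegral.integral_nonneg hxy fun _ _ => norm_nonneg _⟩)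
    have n1 : ‖Y y - Y x‖ ≤ |∫ t in x..y, ‖f t‖| := by
      rw [hY.sub_eq x (hsub hx) y (hsub hy)]
      exact intervalIntegral.norm_integral_le_abs_integral_norm
    have n2 : ‖Z y - Z x‖ ≤ |∫ t in x..y, ‖g t‖| := by
      rw [hZ.sub_eq x (hsub hx) y (hsub hy)]
      exact intervalIntegral.norm_integral_le_abs_integral_norm
    have hM' : ‖Y y‖ ≤ |M| + |N| := (hM y hy).trans ((le_abs_self M).trans (by simp))
    have hN' : ‖Z x‖ ≤ |M| + |N| := (hN x hx).trans ((le_abs_self N).trans (by simp))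
    rw [e, hsum]
    calc _ ≤ ‖B (Y y, Z y - Z x)‖ + ‖B (Y y - Y x, Z x)‖ := norm_add_le _ _
      _ ≤ C * ‖Y y‖ * ‖Z y - Z x‖ + C * ‖Y y - Y x‖ * ‖Z x‖ := add_le_add (hb _ _) (hb _ _)
      _ ≤ C * (|M| + |N|) * |∫ t in x..y, ‖g t‖| + C * |∫ t in x..y, ‖f t‖| * (|M| + |N|) := by
        gcongr
      _ = _ := by ring
  · filter_upwards [(hY.integrable c hc d hd).ae_hasDerivAt_integral,
      (hZ.integrable c hc d hd).ae_hasDerivAt_integral,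
      (measure_eq_zero_iff_ae_notMem.1 (measure_singleton c : volume {c} = 0)),
      (measure_eq_zero_iff_ae_notMem.1 (measure_singleton d : volume {d} = 0))] with x h1 h2 xc xd hx
    have hnhds : uIcc c d ∈ 𝓝 x := by
      simp only [mem_singleton_iff] at xc xd
      rcases le_total c d with hcd | hcd
      · rw [uIcc_of_le hcd] at hx ⊢
        exact Icc_mem_nhds (lt_of_le_of_ne hx.1 (Ne.symm xc)) (lt_of_le_of_ne hx.2 xd)
      · rw [uIcc_of_ge hcd] at hx ⊢
        exact Icc_mem_nhds (lt_of_le_of_ne hx.1 (Ne.symm xd)) (lt_of_le_of_ne hx.2 xc)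
    have dY : HasDerivAt Y (f x) x := by
      refine ((h1 hx c left_mem_uIcc).const_add (Y c)).congr_of_eventuallyEq ?_
      filter_upwards [hnhds] with y hy
      rw [← hY.sub_eq c hc y (hsub hy)]; abel
    have dZ : HasDerivAt Z (g x) x := by
      refine ((h2 hx c left_mem_uIcc).const_add (Z c)).congr_of_eventuallyEq ?_
      filter_upwards [hnhds] with y hy
      rw [← hZ.sub_eq c hc y (hsub hy)]; abel
    have := (hB.hasFDerivAt (Y x, Z x)).comp_hasDerivAt x (dY.prodMk dZ)
    simpa using! this

end Primitive

/-! ### Linear differential equations with locally integrable coefficients -/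

section LinearODE

variable {E : Type*} [NormedAddCommGroup E] [NormedSpace ℂ E] {I : Set ℝ}

/-- Hypotheses on the coefficient of the linear equation `X' = A X` on `I`: it is dominated by a
locally integrable function, and it maps continuous functions to measurable ones. -/
structure IsLinearCoeff (I : Set ℝ) (A : ℝ → E →L[ℂ] E) (κ : ℝ → ℝ) : Prop where
  norm_le : ∀ x, ‖A x‖ ≤ κ x
  integrable : ∀ c ∈ I, ∀ d ∈ I, IntervalIntegrable κ volume c d
  measurable : ∀ c ∈ I, ∀ d ∈ I, ∀ X : ℝ → E, ContinuousOn X (uIcc c d) →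
    AEStronglyMeasurable (fun t => A t (X t)) (volume.restrict (uIoc c d))

lemma IsLinearCoeff.nonneg {A : ℝ → E →L[ℂ] E} {κ : ℝ → ℝ} (h : IsLinearCoeff I A κ) (x : ℝ) :
    0 ≤ κ x := (norm_nonneg _).trans (h.norm_le x)

lemma IsLinearCoeff.intervalIntegrable {A : ℝ → E →L[ℂ] E} {κ : ℝ → ℝ} (h : IsLinearCoeff I A κ)
    {c d : ℝ} (hc : c ∈ I) (hd : d ∈ I) {X : ℝ → E} (hX : ContinuousOn X (uIcc c d)) :
    IntervalIntegrable (fun t => A t (X t)) volume c d := by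
  obtain ⟨M, hM⟩ := isCompact_uIcc.exists_bound_of_continuousOn hX
  have hκ := h.integrable c hc d hd
  rw [intervalIntegrable_iff] at hκ ⊢
  refine Integrable.mono' (hκ.mul_const M) (h.measurable c hc d hd X hX) ?_
  refine (ae_restrict_iff' measurableSet_uIoc).2 (ae_of_all _ fun t ht => ?_)
  refine ((A t).le_opNorm _).trans ?_
  have := hM t (uIoc_subset_uIcc ht)
  have := h.norm_le t
  have := h.nonneg t
  gcongr

/-- `∫_c^x κ |L|ⁿ = |L(x)|ⁿ⁺¹ / (n + 1)` in absolute value, where `L` is the primitive of `κ ≥ 0`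
that vanishes at `c`. -/
lemma abs_integral_mul_abs_primitive_pow {κ : ℝ → ℝ} (hκ0 : ∀ x, 0 ≤ κ x) {c x : ℝ}
    (hκ : IntervalIntegrable κ volume c x) (n : ℕ) :
    |∫ t in c..x, κ t * |∫ s in c..t, κ s| ^ n| = |∫ s in c..x, κ s| ^ (n + 1) / (n + 1) := by
  set L : ℝ → ℝ := fun t => ∫ s in c..t, κ s
  have hLc : ContinuousOn L (uIcc c x) :=
    intervalIntegral.continuousOn_primitive_interval' hκ left_mem_uIcc
  obtain ⟨M, hM⟩ := isCompact_uIcc.exists_bound_of_continuousOn hLc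
  have hpow : ∀ n : ℕ, IntervalIntegrable (fun t => κ t * L t ^ n) volume c x := fun n =>
    hκ.mul_continuousOn (hLc.pow n)
  have hprim : IsPrimitiveOn (uIcc c x) L κ :=
    isPrimitiveOn_of_base (c := c) (fun y hy => hκ.mono_set (uIcc_subset_uIcc left_mem_uIcc hy))
      fun y hy => by simp [L]
  have key : ∀ n : ℕ, IsPrimitiveOn (uIcc c x) (fun t => L t ^ (n + 1) / (n + 1))
      (fun t => κ t * L t ^ n) := by
    intro n
    have h : IsPrimitiveOn (uIcc c x) (fun t => L t ^ (n + 1))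
        (fun t => (n + 1) * (κ t * L t ^ n)) := by
      induction n with
      | zero => simpa using hprim
      | succ n ih =>
        have := IsPrimitiveOn.bilin (isBoundedBilinearMap_mul (𝕜 := ℝ) (A := ℝ)) ih hprim
        refine this.congr (fun t _ => by simp only; ring) (ae_of_all _ fun t _ => ?_)
        push_cast
        ring
    refine ⟨fun d hd e he => ?_, fun d hd e he => ?_⟩
    · have := (h.integrable d hd e he).const_mul (1 / ((n : ℝ) + 1))
      refine this.congr (fun t _ => ?_)
      have : (n : ℝ) + 1 ≠ 0 := by positivity
      field_simp
    · have := h.sub_eq d hd e he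
      rw [intervalIntegral.integral_const_mul] at this
      have hn : (n : ℝ) + 1 ≠ 0 := by positivity
      rw [← sub_div, this]
      field_simp
  have hval := (key n).sub_eq c left_mem_uIcc x right_mem_uIcc
  have hLc0 : L c = 0 := by simp [L]
  rw [hLc0, zero_pow n.succ_ne_zero, zero_div, sub_zero] at hval
  have habs : |∫ t in c..x, κ t * |L t| ^ n| = |∫ t in c..x, κ t * L t ^ n| := by
    rcases le_total c x with hcx | hcx
    · congr 1
      refine intervalIntegral.integral_congr fun t ht => ?_
      rw [uIcc_of_le hcx] at ht
      rw [abs_of_nonneg (intervalIntegral.integral_nonneg ht.1 fun _ _ => hκ0 _)]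
    · have : ∫ t in c..x, κ t * |L t| ^ n = (-1) ^ n * ∫ t in c..x, κ t * L t ^ n := by
        rw [← intervalIntegral.integral_const_mul]
        refine intervalIntegral.integral_congr fun t ht => ?_
        rw [uIcc_of_ge hcx] at ht
        have h0 : L t ≤ 0 := by
          simp only [L]
          rw [intervalIntegral.integral_symm]
          exact neg_nonpos.2 (intervalIntegral.integral_nonneg ht.2 fun _ _ => hκ0 _)
        rw [abs_of_nonpos h0, neg_pow]
        ring
      rw [this, abs_mul, abs_pow]
      simp
  rw [habs, ← hval, abs_div, abs_pow, abs_of_nonneg (by positivity : (0 : ℝ) ≤ (n : ℝ) + 1)]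

/-- The step of the Picard iteration: the bound `M |L|ⁿ / n!` propagates. -/
lemma IsLinearCoeff.norm_integral_le {A : ℝ → E →L[ℂ] E} {κ : ℝ → ℝ} (h : IsLinearCoeff I A κ)
    {c x : ℝ} (hc : c ∈ I) (hx : x ∈ I) {X : ℝ → E} {M : ℝ} (hM : 0 ≤ M) (n : ℕ)
    (hb : ∀ t ∈ uIcc c x, ‖X t‖ ≤ M * (|∫ s in c..t, κ s| ^ n / n.factorial)) :
    ‖∫ t in c..x, A t (X t)‖ ≤ M * (|∫ s in c..x, κ s| ^ (n + 1) / (n + 1).factorial) := by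
  have hκ := h.integrable c hc x hx
  have hLc : ContinuousOn (fun t => ∫ s in c..t, κ s) (uIcc c x) :=
    intervalIntegral.continuousOn_primitive_interval' hκ left_mem_uIcc
  have hint : IntervalIntegrable (fun t => (M / n.factorial) * (κ t * |∫ s in c..t, κ s| ^ n))
      volume c x := (hκ.mul_continuousOn (hLc.abs.pow n)).const_mul _
  have h1 : ‖∫ t in c..x, A t (X t)‖ ≤
      |∫ t in c..x, (M / n.factorial) * (κ t * |∫ s in c..t, κ s| ^ n)| := by
    refine intervalIntegral.norm_integral_le_abs_of_norm_le ?_ hint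
    refine (ae_restrict_iff' measurableSet_uIoc).2 (ae_of_all _ fun t ht => ?_)
    have h2 := hb t (uIoc_subset_uIcc ht)
    calc ‖A t (X t)‖ ≤ ‖A t‖ * ‖X t‖ := (A t).le_opNorm _
      _ ≤ κ t * (M * (|∫ s in c..t, κ s| ^ n / n.factorial)) :=
        mul_le_mul (h.norm_le t) h2 (norm_nonneg _) (h.nonneg t)
      _ = _ := by ring
  refine h1.trans (le_of_eq ?_)
  rw [intervalIntegral.integral_const_mul, abs_mul,
    abs_integral_mul_abs_primitive_pow h.nonneg hκ, abs_div, Nat.abs_cast, Nat.factorial_succ,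
    abs_of_nonneg hM]
  have : (n.factorial : ℝ) ≠ 0 := by positivity
  push_cast
  field_simp

/-- The terms of the Picard series for `X = g + ∫_c A X`. -/
noncomputable def picardTerm (A : ℝ → E →L[ℂ] E) (c : ℝ) (g : ℝ → E) : ℕ → ℝ → E
  | 0 => g
  | n + 1 => fun x => ∫ t in c..x, A t (picardTerm A c g n t)

variable {A : ℝ → E →L[ℂ] E} {κ : ℝ → ℝ} {c : ℝ} {g : ℝ → E}

lemma IsLinearCoeff.isPrimitiveOn_integral (h : IsLinearCoeff I A κ) (hc : c ∈ I) {X : ℝ → E}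
    (hX : ∀ x ∈ I, ∀ y ∈ I, ContinuousOn X (uIcc x y)) :
    IsPrimitiveOn I (fun x => ∫ t in c..x, A t (X t)) (fun t => A t (X t)) :=
  isPrimitiveOn_of_base (c := c) (fun x hx => h.intervalIntegrable hc hx (hX c hc x hx))
    fun x _ => by simp

variable [I.OrdConnected]

lemma continuousOn_picardTerm (h : IsLinearCoeff I A κ) (hc : c ∈ I)
    (hg : ∀ x ∈ I, ∀ y ∈ I, ContinuousOn g (uIcc x y)) (n : ℕ) :
    ∀ x ∈ I, ∀ y ∈ I, ContinuousOn (picardTerm A c g n) (uIcc x y) := by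
  induction n with
  | zero => exact hg
  | succ n ih => exact fun x hx y hy => (h.isPrimitiveOn_integral hc ih).continuousOn hx hy

lemma norm_picardTerm_le (h : IsLinearCoeff I A κ) (hc : c ∈ I) {x M : ℝ} (hx : x ∈ I) (hM : 0 ≤ M)
    (hb : ∀ t ∈ uIcc c x, ‖g t‖ ≤ M) (n : ℕ) :
    ∀ t ∈ uIcc c x, ‖picardTerm A c g n t‖ ≤ M * (|∫ s in c..t, κ s| ^ n / n.factorial) := by
  induction n with
  | zero => intro t ht; simpa [picardTerm] using hb t ht
  | succ n ih =>
    intro t ht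
    exact h.norm_integral_le hc (‹I.OrdConnected›.uIcc_subset hc hx ht) hM n fun s hs =>
      ih s (uIcc_subset_uIcc left_mem_uIcc ht hs)

/-- Uniqueness for the homogeneous Volterra equation. -/
lemma IsLinearCoeff.eq_zero (h : IsLinearCoeff I A κ) (hc : c ∈ I) {x : ℝ} (hx : x ∈ I)
    {X : ℝ → E} (hX : ContinuousOn X (uIcc c x))
    (heq : ∀ t ∈ uIcc c x, X t = ∫ s in c..t, A s (X s)) : X x = 0 := by
  obtain ⟨M, hM⟩ := isCompact_uIcc.exists_bound_of_continuousOn hX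
  have hM0 : 0 ≤ M := (norm_nonneg _).trans (hM c left_mem_uIcc)
  have hb : ∀ n : ℕ, ∀ t ∈ uIcc c x,
      ‖X t‖ ≤ M * (|∫ s in c..t, κ s| ^ n / n.factorial) := by
    intro n
    induction n with
    | zero => intro t ht; simpa using hM t ht
    | succ n ih =>
      intro t ht
      rw [heq t ht]
      exact h.norm_integral_le hc (‹I.OrdConnected›.uIcc_subset hc hx ht) hM0 n fun s hs =>
        ih s (uIcc_subset_uIcc left_mem_uIcc ht hs)
  have hlim : Tendsto (fun n : ℕ => M * (|∫ s in c..x, κ s| ^ n / n.factorial)) atTop (𝓝 0) := by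
    simpa using (FloorSemiring.tendsto_pow_div_factorial_atTop (|∫ s in c..x, κ s|)).const_mul M
  exact norm_le_zero_iff.1 (ge_of_tendsto' hlim fun n => hb n x right_mem_uIcc)

variable [CompleteSpace E]

/-- Existence for the Volterra equation `X = g + ∫_c A X`, with the exponential bound. -/
lemma IsLinearCoeff.exists_solution (h : IsLinearCoeff I A κ) (hc : c ∈ I)
    (hg : ∀ x ∈ I, ∀ y ∈ I, ContinuousOn g (uIcc x y)) :
    ∃ X : ℝ → E, (∀ x ∈ I, ∀ y ∈ I, ContinuousOn X (uIcc x y)) ∧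
      (∀ x ∈ I, X x = g x + ∫ t in c..x, A t (X t)) ∧
      ∀ x ∈ I, ∀ M, 0 ≤ M → (∀ t ∈ uIcc c x, ‖g t‖ ≤ M) →
        ‖X x‖ ≤ M * Real.exp |∫ s in c..x, κ s| := by
  set P := picardTerm A c g
  have hL : ∀ x ∈ I, ∃ Λ : ℝ, ∀ t ∈ uIcc c x, |∫ s in c..t, κ s| ≤ Λ := by
    intro x hx
    obtain ⟨Λ, hΛ⟩ := isCompact_uIcc.exists_bound_of_continuousOn
      (intervalIntegral.continuousOn_primitive_interval' (h.integrable c hc x hx) left_mem_uIcc)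
    exact ⟨Λ, hΛ⟩
  have hM : ∀ x ∈ I, ∃ M : ℝ, 0 ≤ M ∧ ∀ t ∈ uIcc c x, ‖g t‖ ≤ M := by
    intro x hx
    obtain ⟨M, hM⟩ := isCompact_uIcc.exists_bound_of_continuousOn (hg c hc x hx)
    exact ⟨M, (norm_nonneg _).trans (hM c left_mem_uIcc), hM⟩
  have hbd : ∀ x ∈ I, ∃ M Λ : ℝ, ∀ n, ∀ t ∈ uIcc c x, ‖P n t‖ ≤ M * (Λ ^ n / n.factorial) := by
    intro x hx
    obtain ⟨Λ, hΛ⟩ := hL x hx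
    obtain ⟨M, hM0, hM⟩ := hM x hx
    refine ⟨M, Λ, fun n t ht => (norm_picardTerm_le h hc hx hM0 hM n t ht).trans ?_⟩
    have := hΛ t ht
    gcongr
  have hsm : ∀ M Λ : ℝ, Summable fun n : ℕ => M * (Λ ^ n / n.factorial) := fun M Λ =>
    (Real.summable_pow_div_factorial Λ).mul_left M
  have hPs : ∀ x ∈ I, Summable fun n => P n x := by
    intro x hx
    obtain ⟨M, Λ, hb⟩ := hbd x hx
    exact (hsm M Λ).of_norm_bounded fun n => hb n x right_mem_uIcc
  have hPc := continuousOn_picardTerm h hc hg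
  have hXc0 : ∀ x ∈ I, ContinuousOn (fun x => ∑' n, P n x) (uIcc c x) := by
    intro x hx
    obtain ⟨M, Λ, hb⟩ := hbd x hx
    exact continuousOn_tsum (fun n => hPc n c hc x hx) (hsm M Λ) fun n t ht => hb n t ht
  have hXc : ∀ x ∈ I, ∀ y ∈ I, ContinuousOn (fun x => ∑' n, P n x) (uIcc x y) := by
    intro x hx y hy
    refine ContinuousOn.mono ?_ (uIcc_subset_uIcc_union_uIcc (b := c))
    rw [uIcc_comm x c]
    exact (hXc0 x hx).union_of_isClosed (hXc0 y hy) isClosed_Icc isClosed_Icc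
  refine ⟨fun x => ∑' n, P n x, hXc, fun x hx => ?_, fun x hx M hM0 hgM => ?_⟩
  · obtain ⟨M, Λ, hb⟩ := hbd x hx
    have hκ := h.integrable c hc x hx
    have hsum : HasSum (fun n => ∫ t in c..x, A t (P n t)) (∫ t in c..x, A t (∑' n, P n t)) := by
      refine intervalIntegral.hasSum_integral_of_dominated_convergence
        (fun n t => κ t * (M * (Λ ^ n / n.factorial))) (fun n => ?_) (fun n => ?_) ?_ ?_ ?_
      · exact h.measurable c hc x hx _ (hPc n c hc x hx)
      · refine ae_of_all _ fun t ht => ((A t).le_opNorm _).trans ?_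
        exact mul_le_mul (h.norm_le t) (hb n t (uIoc_subset_uIcc ht)) (norm_nonneg _) (h.nonneg t)
      · exact ae_of_all _ fun t _ => (hsm M Λ).mul_left _
      · simp_rw [tsum_mul_left]
        exact hκ.mul_const _
      · refine ae_of_all _ fun t ht => ?_
        exact (hPs t (‹I.OrdConnected›.uIcc_subset hc hx (uIoc_subset_uIcc ht))).hasSum.mapL (A t)
    show ∑' n, P n x = g x + ∫ t in c..x, A t (∑' n, P n t)
    rw [(hPs x hx).tsum_eq_zero_add, hsum.tsum_eq.symm]
    rfl
  · have hb := fun n => norm_picardTerm_le h hc hx hM0 hgM n x right_mem_uIcc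
    refine tsum_of_norm_bounded ?_ hb
    refine HasSum.mul_left M ?_
    rw [Real.exp_eq_exp_ℝ]
    exact NormedSpace.expSeries_div_hasSum_exp _

end LinearODE

/-! ### Measurability in a separable Hilbert space -/

section Measurability

variable {H : Type*} [NormedAddCommGroup H] [InnerProductSpace ℂ H] [CompleteSpace H]
  [TopologicalSpace.SeparableSpace H]

lemma exists_countable_hilbertBasis (H : Type*) [NormedAddCommGroup H] [InnerProductSpace ℂ H]
    [CompleteSpace H] [TopologicalSpace.SeparableSpace H] :
    ∃ (s : Set H) (_ : HilbertBasis s ℂ H), s.Countable := by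
  obtain ⟨s, b, hb⟩ := exists_hilbertBasis ℂ H
  refine ⟨s, b, ?_⟩
  have horth : Orthonormal ℂ ((↑) : s → H) := hb ▸ b.orthonormal
  -- orthonormal vectors are at distance `√2`, so the balls of radius `1 / 2` are disjoint
  refine PairwiseDisjoint.countable_of_isOpen (s := fun x : H => Metric.ball x (1 / 2)) ?_
    (fun _ _ => Metric.isOpen_ball) fun x _ => ⟨x, Metric.mem_ball_self (by norm_num)⟩
  intro x hx y hy hxy
  refine Metric.ball_disjoint_ball ?_
  have h0 : inner ℂ x y = 0 :=
    horth.2 (i := ⟨x, hx⟩) (j := ⟨y, hy⟩) fun h => hxy (congrArg Subtype.val h)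
  have h1 : ‖x‖ = 1 := horth.1 ⟨x, hx⟩
  have h2 : ‖y‖ = 1 := horth.1 ⟨y, hy⟩
  have h3 := norm_sub_sq (𝕜 := ℂ) x y
  rw [h0, h1, h2] at h3
  rw [dist_eq_norm]
  norm_num at h3 ⊢
  nlinarith [norm_nonneg (x - y)]

/-- Pettis' theorem in a separable Hilbert space. -/
lemma aestronglyMeasurable_of_inner {μ : Measure ℝ} {f : ℝ → H}
    (hf : ∀ g : H, AEMeasurable (fun x => inner ℂ g (f x)) μ) : AEStronglyMeasurable f μ := by
  obtain ⟨s, b, hs⟩ := exists_countable_hilbertBasis H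
  have : Countable s := hs.to_subtype
  refine aestronglyMeasurable_of_tendsto_ae atTop
    (f := fun (t : Finset s) x => ∑ i ∈ t, b.repr (f x) i • b i) (fun t => ?_)
    (ae_of_all _ fun x => b.hasSum_repr (f x))
  refine Finset.aestronglyMeasurable_fun_sum _ fun i _ => ?_
  simp_rw [b.repr_apply_apply]
  exact (hf (b i)).aestronglyMeasurable.smul_const _

lemma aestronglyMeasurable_clm_apply {μ : Measure ℝ} {T : ℝ → H →L[ℂ] H} {X : ℝ → H}
    (hT : ∀ h, AEStronglyMeasurable (fun x => T x h) μ) (hX : AEStronglyMeasurable X μ) :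
    AEStronglyMeasurable (fun x => T x (X x)) μ := by
  obtain ⟨s, b, hs⟩ := exists_countable_hilbertBasis H
  have : Countable s := hs.to_subtype
  refine aestronglyMeasurable_of_tendsto_ae atTop
    (f := fun (t : Finset s) x => ∑ i ∈ t, b.repr (X x) i • T x (b i)) (fun t => ?_)
    (ae_of_all _ fun x => ?_)
  · refine Finset.aestronglyMeasurable_fun_sum _ fun i _ => ?_
    simp_rw [b.repr_apply_apply]
    exact (aestronglyMeasurable_const.inner hX).smul (hT _)
  · have := (b.hasSum_repr (X x)).mapL (T x)
    simp only [map_smul] at this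
    exact this

end Measurability

/-! ### The second-order equation -/

section SecondOrder

variable {H : Type*} [NormedAddCommGroup H] [InnerProductSpace ℂ H] {I : Set ℝ}

lemma isW21Loc_iff {y y₁ y₂ : ℝ → H} :
    IsW21Loc I y y₁ y₂ ↔ IsPrimitiveOn I y y₁ ∧ IsPrimitiveOn I y₁ y₂ :=
  ⟨fun h => ⟨⟨h.1, h.3⟩, ⟨h.2, h.4⟩⟩, fun h => ⟨h.1.1, h.2.1, h.1.2, h.2.2⟩⟩

lemma IsW21Loc.mono {J : Set ℝ} {y y₁ y₂ : ℝ → H} (h : IsW21Loc I y y₁ y₂) (hJ : J ⊆ I) :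
    IsW21Loc J y y₁ y₂ :=
  isW21Loc_iff.2 ⟨(isW21Loc_iff.1 h).1.mono hJ, (isW21Loc_iff.1 h).2.mono hJ⟩

lemma IsW21Loc.congr [I.OrdConnected] {y y₁ y₂ v v₁ v₂ : ℝ → H} (h : IsW21Loc I y y₁ y₂)
    (h0 : ∀ x ∈ I, v x = y x) (h1 : ∀ x ∈ I, v₁ x = y₁ x) (h2 : ∀ᵐ x, x ∈ I → y₂ x = v₂ x) :
    IsW21Loc I v v₁ v₂ := by
  obtain ⟨h3, h4⟩ := isW21Loc_iff.1 h
  exact isW21Loc_iff.2 ⟨h3.congr h0 (ae_of_all _ fun x hx => (h1 x hx).symm), h4.congr h1 h2⟩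

lemma IsW21Loc.sub {y y₁ y₂ v v₁ v₂ : ℝ → H} (hy : IsW21Loc I y y₁ y₂)
    (hv : IsW21Loc I v v₁ v₂) : IsW21Loc I (y - v) (y₁ - v₁) (y₂ - v₂) := by
  simpa [sub_eq_add_neg] using hy.add (hv.smul (-1))

lemma IsW21Loc.continuousOn [I.OrdConnected] {y y₁ y₂ : ℝ → H} (h : IsW21Loc I y y₁ y₂) {c d : ℝ}
    (hc : c ∈ I) (hd : d ∈ I) : ContinuousOn y (uIcc c d) :=
  (isW21Loc_iff.1 h).1.continuousOn hc hd

lemma IsW21Loc.continuousOn_deriv [I.OrdConnected] {y y₁ y₂ : ℝ → H} (h : IsW21Loc I y y₁ y₂)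
    {c d : ℝ} (hc : c ∈ I) (hd : d ∈ I) : ContinuousOn y₁ (uIcc c d) :=
  (isW21Loc_iff.1 h).2.continuousOn hc hd

variable [CompleteSpace H]

/-- Green's identity `[(y, v') - (y', v)]_c^d = ∫_c^d (y, v'') - (y'', v)`. -/
lemma IsW21Loc.green [I.OrdConnected] {y y₁ y₂ v v₁ v₂ : ℝ → H} (hy : IsW21Loc I y y₁ y₂)
    (hv : IsW21Loc I v v₁ v₂) {c d : ℝ} (hc : c ∈ I) (hd : d ∈ I) :
    (inner ℂ (y d) (v₁ d) - inner ℂ (y₁ d) (v d)) - (inner ℂ (y c) (v₁ c) - inner ℂ (y₁ c) (v c)) =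
      ∫ t in c..d, (inner ℂ (y t) (v₂ t) - inner ℂ (y₂ t) (v t)) := by
  obtain ⟨y1, y2⟩ := isW21Loc_iff.1 hy
  obtain ⟨v1, v2⟩ := isW21Loc_iff.1 hv
  have h1 := y1.bilin (isBoundedBilinearMap_inner (𝕜 := ℂ) (E := H)) v2
  have h2 := y2.bilin (isBoundedBilinearMap_inner (𝕜 := ℂ) (E := H)) v1
  have e1 := h1.sub_eq c hc d hd
  have e2 := h2.sub_eq c hc d hd
  have : ∫ t in c..d, (inner ℂ (y t) (v₂ t) - inner ℂ (y₂ t) (v t)) =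
      (∫ t in c..d, (inner ℂ (y t) (v₂ t) + inner ℂ (y₁ t) (v₁ t))) -
      ∫ t in c..d, (inner ℂ (y₁ t) (v₁ t) + inner ℂ (y₂ t) (v t)) := by
    rw [← intervalIntegral.integral_sub (h1.integrable c hc d hd) (h2.integrable c hc d hd)]
    refine intervalIntegral.integral_congr fun t _ => ?_
    simp only
    ring
  rw [this, ← e1, ← e2]
  ring

/-- The product rule in `W^{2,1}_loc` for a smooth scalar factor. -/
lemma IsW21Loc.smooth_smul [I.OrdConnected] {y y₁ y₂ : ℝ → H} (hy : IsW21Loc I y y₁ y₂)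
    {χ χ₁ χ₂ : ℝ → ℝ} (h1 : ∀ x, HasDerivAt χ (χ₁ x) x) (h2 : ∀ x, HasDerivAt χ₁ (χ₂ x) x)
    (h3 : Continuous χ₂) :
    IsW21Loc I (fun x => χ x • y x) (fun x => χ x • y₁ x + χ₁ x • y x)
      (fun x => χ x • y₂ x + (2 : ℝ) • χ₁ x • y₁ x + χ₂ x • y x) := by
  obtain ⟨y1, y2⟩ := isW21Loc_iff.1 hy
  have hc1 : Continuous χ₁ := continuous_iff_continuousAt.2 fun x => (h2 x).continuousAt
  have p1 : IsPrimitiveOn I χ χ₁ := ⟨fun c _ d _ => hc1.intervalIntegrable c d, fun c _ d _ =>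
    (intervalIntegral.integral_eq_sub_of_hasDerivAt (fun x _ => h1 x)
      (hc1.intervalIntegrable c d)).symm⟩
  have p2 : IsPrimitiveOn I χ₁ χ₂ := ⟨fun c _ d _ => h3.intervalIntegrable c d, fun c _ d _ =>
    (intervalIntegral.integral_eq_sub_of_hasDerivAt (fun x _ => h2 x)
      (h3.intervalIntegrable c d)).symm⟩
  have hB := isBoundedBilinearMap_smul (𝕜 := ℝ) (A := ℝ) (E := H)
  refine isW21Loc_iff.2 ⟨p1.bilin hB y1, ?_⟩
  refine ((p1.bilin hB y2).add (p2.bilin hB y1)).congr (fun _ _ => rfl) (ae_of_all _ fun x _ => ?_)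
  simp only [two_smul]
  abel

/-- Hypotheses on the operator coefficient of `y'' = Q y` on `I`: strong measurability and a
locally integrable bound for the norm. -/
structure IsCoeff (I : Set ℝ) (Q : ℝ → H →L[ℂ] H) (κ : ℝ → ℝ) : Prop where
  norm_le : ∀ x, ‖Q x‖ ≤ κ x
  integrable : ∀ c ∈ I, ∀ d ∈ I, IntervalIntegrable κ volume c d
  measurable : ∀ h, ∀ c ∈ I, ∀ d ∈ I,
    AEStronglyMeasurable (fun x => Q x h) (volume.restrict (uIoc c d))

/-- The coefficient of the first-order system for `(y, y')` equivalent to `y'' = Q y`. -/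
noncomputable def systemCoeff (Q : ℝ → H →L[ℂ] H) (x : ℝ) : H × H →L[ℂ] H × H :=
  (ContinuousLinearMap.snd ℂ H H).prod ((Q x).comp (ContinuousLinearMap.fst ℂ H H))

variable [TopologicalSpace.SeparableSpace H] {Q : ℝ → H →L[ℂ] H} {κ : ℝ → ℝ} {c : ℝ}

lemma IsCoeff.isLinearCoeff (hQ : IsCoeff I Q κ) :
    IsLinearCoeff I (systemCoeff Q) (fun x => 1 + κ x) where
  norm_le x := by
    have h0 := (norm_nonneg _).trans (hQ.norm_le x)
    refine ContinuousLinearMap.opNorm_le_bound _ (by positivity) fun ξ => ?_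
    refine norm_prod_le_iff.2 ⟨?_, ?_⟩
    · calc ‖ξ.2‖ ≤ ‖ξ‖ := norm_snd_le ξ
        _ ≤ (1 + κ x) * ‖ξ‖ := by nlinarith [norm_nonneg ξ]
    · calc ‖Q x ξ.1‖ ≤ ‖Q x‖ * ‖ξ.1‖ := (Q x).le_opNorm _
        _ ≤ κ x * ‖ξ‖ := mul_le_mul (hQ.norm_le x) (norm_fst_le ξ) (norm_nonneg _) h0
        _ ≤ (1 + κ x) * ‖ξ‖ := by nlinarith [norm_nonneg ξ]
  integrable c hc d hd := intervalIntegrable_const.add (hQ.integrable c hc d hd)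
  measurable c hc d hd X hX := by
    have hX' : AEStronglyMeasurable X (volume.restrict (uIoc c d)) :=
      (hX.mono uIoc_subset_uIcc).aestronglyMeasurable measurableSet_uIoc
    exact (continuous_snd.comp_aestronglyMeasurable hX').prodMk
      (aestronglyMeasurable_clm_apply (fun h => hQ.measurable h c hc d hd)
        (continuous_fst.comp_aestronglyMeasurable hX'))

variable [I.OrdConnected]

/-- The initial value problem `y'' = Q y - w`, with an a priori bound. -/
lemma IsCoeff.exists_solution (hQ : IsCoeff I Q κ) (hc : c ∈ I) (p q : H) {w : ℝ → H}
    (hw : ∀ x ∈ I, ∀ y ∈ I, IntervalIntegrable w volume x y) :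
    ∃ y y₁ : ℝ → H, IsW21Loc I y y₁ (fun x => Q x (y x) - w x) ∧ y c = p ∧ y₁ c = q ∧
      ∀ x ∈ I, ∀ M, 0 ≤ M → (∀ t ∈ uIcc c x, ‖(p, q - ∫ s in c..t, w s)‖ ≤ M) →
        ‖(y x, y₁ x)‖ ≤ M * Real.exp |∫ s in c..x, (1 + κ s)| := by
  have hA := hQ.isLinearCoeff
  have hwp : IsPrimitiveOn I (fun x => ∫ s in c..x, w s) w :=
    isPrimitiveOn_of_base (c := c) (fun x hx => hw c hc x hx) fun x _ => by simp
  obtain ⟨X, hXc, hXe, hXb⟩ := hA.exists_solution hc (g := fun t => (p, q - ∫ s in c..t, w s))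
    fun x hx y hy => continuousOn_const.prodMk (continuousOn_const.sub (hwp.continuousOn hx hy))
  have hXp := hA.isPrimitiveOn_integral hc hXc
  have hfst : ∀ x ∈ I, (X x).1 = p + ∫ t in c..x, (X t).2 := by
    intro x hx
    have h1 := (ContinuousLinearMap.fst ℝ H H).intervalIntegral_comp_comm
      (hXp.integrable c hc x hx)
    have h2 := congrArg Prod.fst (hXe x hx)
    rw [Prod.fst_add] at h2
    rw [h2]
    exact congrArg (p + ·) h1.symm
  have hsnd : ∀ x ∈ I, (X x).2 = (q - ∫ s in c..x, w s) + ∫ t in c..x, Q t (X t).1 := by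
    intro x hx
    have h1 := (ContinuousLinearMap.snd ℝ H H).intervalIntegral_comp_comm
      (hXp.integrable c hc x hx)
    have h2 := congrArg Prod.snd (hXe x hx)
    rw [Prod.snd_add] at h2
    rw [h2]
    exact congrArg ((q - ∫ s in c..x, w s) + ·) h1.symm
  have hc1 : (X c).1 = p := by simpa using hfst c hc
  have hc2 : (X c).2 = q := by simpa using hsnd c hc
  have hQi : ∀ x ∈ I, IntervalIntegrable (fun t => Q t (X t).1) volume c x := by
    intro x hx
    have h1 := hXp.integrable c hc x hx
    rw [intervalIntegrable_iff] at h1 ⊢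
    exact h1.snd
  refine ⟨fun x => (X x).1, fun x => (X x).2, isW21Loc_iff.2 ⟨?_, ?_⟩, hc1, hc2, hXb⟩
  · refine isPrimitiveOn_of_base (c := c) (fun x hx => ?_) fun x hx => by rw [hc1, hfst x hx]
    exact (continuous_snd.comp_continuousOn (hXc c hc x hx)).intervalIntegrable
  · refine isPrimitiveOn_of_base (c := c) (fun x hx => (hQi x hx).sub (hw c hc x hx))
      fun x hx => ?_
    rw [hc2, hsnd x hx, intervalIntegral.integral_sub (hQi x hx) (hw c hc x hx)]
    abel

/-- Uniqueness for `y'' = Q y`. -/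
lemma IsCoeff.eq_zero (hQ : IsCoeff I Q κ) (hc : c ∈ I) {y y₁ y₂ : ℝ → H}
    (hy : IsW21Loc I y y₁ y₂) (heq : ∀ᵐ x, x ∈ I → y₂ x = Q x (y x)) (h0 : y c = 0)
    (h1 : y₁ c = 0) : ∀ x ∈ I, y x = 0 ∧ y₁ x = 0 := by
  have hA := hQ.isLinearCoeff
  have hy' := isW21Loc_iff.1 (hy.congr (fun _ _ => rfl) (fun _ _ => rfl) heq)
  intro x hx
  have hX : ContinuousOn (fun t => (y t, y₁ t)) (uIcc c x) :=
    (hy'.1.continuousOn hc hx).prodMk (hy'.2.continuousOn hc hx)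
  have := hA.eq_zero hc hx hX fun t ht => by
    have htI : t ∈ I := ‹I.OrdConnected›.uIcc_subset hc hx ht
    have hint := hA.intervalIntegrable hc htI (hX.mono (uIcc_subset_uIcc left_mem_uIcc ht))
    refine Prod.ext ?_ ?_
    · have e1 := (ContinuousLinearMap.fst ℝ H H).intervalIntegral_comp_comm hint
      have e2 := hy'.1.sub_eq c hc t htI
      rw [h0, sub_zero] at e2
      exact e2.trans e1
    · have e1 := (ContinuousLinearMap.snd ℝ H H).intervalIntegral_comp_comm hint
      have e2 := hy'.2.sub_eq c hc t htI
      rw [h1, sub_zero] at e2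
      exact e2.trans e1
  exact Prod.ext_iff.1 this

/-- The fundamental system of `y'' = Q y` on `I`: `S x ξ` and `S₁ x ξ` are the values at `x` of the
solution with data `ξ` at `c` and of its derivative. -/
lemma IsCoeff.exists_fundamental (hQ : IsCoeff I Q κ) (hc : c ∈ I) :
    ∃ S S₁ : ℝ → H × H →L[ℂ] H,
      (∀ ξ, IsW21Loc I (fun x => S x ξ) (fun x => S₁ x ξ) (fun x => Q x (S x ξ))) ∧
      (∀ ξ, S c ξ = ξ.1 ∧ S₁ c ξ = ξ.2) ∧
      ∀ x ∈ I, ‖S x‖ ≤ Real.exp |∫ s in c..x, (1 + κ s)| ∧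
        ‖S₁ x‖ ≤ Real.exp |∫ s in c..x, (1 + κ s)| := by
  classical
  have hex : ∀ ξ : H × H, ∃ y y₁ : ℝ → H, IsW21Loc I y y₁ (fun x => Q x (y x)) ∧ y c = ξ.1 ∧
      y₁ c = ξ.2 ∧ ∀ x ∈ I, ‖(y x, y₁ x)‖ ≤ Real.exp |∫ s in c..x, (1 + κ s)| * ‖ξ‖ := by
    intro ξ
    obtain ⟨y, y₁, h1, h2, h3, h4⟩ := hQ.exists_solution hc ξ.1 ξ.2 (w := 0)
      fun x _ y _ => intervalIntegrable_const
    refine ⟨y, y₁, by simpa using h1, h2, h3, fun x hx => ?_⟩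
    rw [mul_comm]
    exact h4 x hx ‖ξ‖ (norm_nonneg _) fun t _ => by simp
  choose y y₁ hy hy0 hy1 hyb using hex
  have hadd : ∀ ξ η, ∀ x ∈ I, y (ξ + η) x = y ξ x + y η x ∧ y₁ (ξ + η) x = y₁ ξ x + y₁ η x := by
    intro ξ η x hx
    have := hQ.eq_zero hc ((hy (ξ + η)).sub ((hy ξ).add (hy η)))
      (ae_of_all _ fun x _ => by simp) (by simp [hy0]) (by simp [hy1]) x hx
    exact ⟨sub_eq_zero.1 this.1, sub_eq_zero.1 this.2⟩
  have hsmul : ∀ (k : ℂ) ξ, ∀ x ∈ I, y (k • ξ) x = k • y ξ x ∧ y₁ (k • ξ) x = k • y₁ ξ x := by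
    intro k ξ x hx
    have := hQ.eq_zero hc ((hy (k • ξ)).sub ((hy ξ).smul k))
      (ae_of_all _ fun x _ => by simp) (by simp [hy0]) (by simp [hy1]) x hx
    exact ⟨sub_eq_zero.1 this.1, sub_eq_zero.1 this.2⟩
  -- off `I` nothing is known about the chosen functions, and the operators are set to zero
  let S : ℝ → H × H →L[ℂ] H := fun x => if hx : x ∈ I then
    LinearMap.mkContinuous ⟨⟨fun ξ => y ξ x, fun ξ η => (hadd ξ η x hx).1⟩,
      fun k ξ => (hsmul k ξ x hx).1⟩ (Real.exp |∫ s in c..x, (1 + κ s)|)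
      (fun ξ => (norm_fst_le (y ξ x, y₁ ξ x)).trans (hyb ξ x hx)) else 0
  let S₁ : ℝ → H × H →L[ℂ] H := fun x => if hx : x ∈ I then
    LinearMap.mkContinuous ⟨⟨fun ξ => y₁ ξ x, fun ξ η => (hadd ξ η x hx).2⟩,
      fun k ξ => (hsmul k ξ x hx).2⟩ (Real.exp |∫ s in c..x, (1 + κ s)|)
      (fun ξ => (norm_snd_le (y ξ x, y₁ ξ x)).trans (hyb ξ x hx)) else 0
  have hS : ∀ x ∈ I, ∀ ξ, S x ξ = y ξ x := fun x hx ξ => by simp [S, hx]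
  have hS₁ : ∀ x ∈ I, ∀ ξ, S₁ x ξ = y₁ ξ x := fun x hx ξ => by simp [S₁, hx]
  refine ⟨S, S₁, fun ξ => ?_, fun ξ => ?_, fun x hx => ⟨?_, ?_⟩⟩
  · exact (hy ξ).congr (fun x hx => hS x hx ξ) (fun x hx => hS₁ x hx ξ)
      (ae_of_all _ fun x hx => by rw [hS x hx])
  · rw [hS c hc, hS₁ c hc]; exact ⟨hy0 ξ, hy1 ξ⟩
  · simp only [S, hx, dite_true]; exact LinearMap.mkContinuous_norm_le _ (Real.exp_nonneg _) _
  · simp only [S₁, hx, dite_true]; exact LinearMap.mkContinuous_norm_le _ (Real.exp_nonneg _) _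

end SecondOrder

/-! ### The Weyl function of an abstract boundary triple -/

section BoundaryTriple

open scoped InnerProductSpace

variable {K H : Type*} [NormedAddCommGroup K] [InnerProductSpace ℂ K]
  [NormedAddCommGroup H] [InnerProductSpace ℂ H]

/-- A boundary triple in graph form. The quadruples `(u, w, f, g)` in `Γ` are the pairs
`(u, w = T u)` in the graph of a maximal operator `T` together with the boundary values `f`, `g`
of `u`. They satisfy Green's identity, there is a bounded right inverse `h ↦ (E h, F h)` of the
first boundary value with vanishing second boundary value, and the restriction of `T` to the
kernel of the first boundary value contains its own adjoint. -/
structure IsBoundaryTriple (Γ : Submodule ℂ (K × K × H × H)) (E F : H →L[ℂ] K) : Prop where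
  green : ∀ {u w f g u' w' f' g'}, (u, w, f, g) ∈ Γ → (u', w', f', g') ∈ Γ →
    ⟪w, u'⟫_ℂ - ⟪u, w'⟫_ℂ = ⟪g, f'⟫_ℂ - ⟪f, g'⟫_ℂ
  lift_mem : ∀ h, (E h, F h, h, 0) ∈ Γ
  maximal : ∀ g k, (∀ u w q, (u, w, 0, q) ∈ Γ → ⟪g, w⟫_ℂ = ⟪k, u⟫_ℂ) → ∃ h, (g, k, 0, h) ∈ Γ

namespace IsBoundaryTriple

variable {Γ : Submodule ℂ (K × K × H × H)} {E F : H →L[ℂ] K}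

/-- The basic resolvent estimate for the self-adjoint restriction. -/
lemma norm_le (h : IsBoundaryTriple Γ E F) {z : ℂ} {u φ : K} {q : H}
    (hu : (u, φ + z • u, 0, q) ∈ Γ) : |z.im| * ‖u‖ ≤ ‖φ‖ := by
  have h1 := h.green hu hu
  simp only [inner_zero_right, inner_zero_left, sub_self, inner_add_left, inner_add_right,
    inner_smul_left, inner_smul_right] at h1
  have h2 := congrArg Complex.im h1
  have h3 : (⟪φ, u⟫_ℂ).im = -(⟪u, φ⟫_ℂ).im := by
    rw [← inner_conj_symm, Complex.conj_im]
  have hn : ⟪u, u⟫_ℂ = ((‖u‖ ^ 2 : ℝ) : ℂ) := by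
    rw [inner_self_eq_norm_sq_to_K]; push_cast; rfl
  rw [hn] at h2
  simp only [Complex.sub_im, Complex.add_im, Complex.mul_im, Complex.conj_im, Complex.conj_re,
    Complex.zero_im, h3, Complex.ofReal_im, Complex.ofReal_re, mul_zero, zero_add] at h2
  have h4 : |z.im| * ‖u‖ ^ 2 = |(⟪u, φ⟫_ℂ).im| := by
    have : z.im * ‖u‖ ^ 2 = -(⟪u, φ⟫_ℂ).im := by linarith
    rw [← abs_of_nonneg (sq_nonneg ‖u‖), ← abs_mul, this, abs_neg]
  have h5 : |(⟪u, φ⟫_ℂ).im| ≤ ‖u‖ * ‖φ‖ := (Complex.abs_im_le_norm _).trans (norm_inner_le_norm _ _)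
  rcases eq_or_ne u 0 with rfl | hu0
  · simp
  · have h6 : 0 < ‖u‖ := norm_pos_iff.2 hu0
    nlinarith

/-- A nonreal `z` is not an eigenvalue of the self-adjoint restriction. -/
lemma eq_zero (h : IsBoundaryTriple Γ E F) {z : ℂ} (hz : z.im ≠ 0) {u : K} {q : H}
    (hu : (u, z • u, 0, q) ∈ Γ) : u = 0 := by
  have := h.norm_le (φ := 0) (by rwa [zero_add])
  rw [norm_zero] at this
  have h1 : 0 < |z.im| := abs_pos.2 hz
  have h2 : ‖u‖ ≤ 0 := by nlinarith [norm_nonneg u]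
  exact norm_le_zero_iff.1 h2

/-- The range of `T - z`, for `T` the self-adjoint restriction. -/
def range (Γ : Submodule ℂ (K × K × H × H)) (z : ℂ) : Submodule ℂ K where
  carrier := {φ | ∃ u q, (u, φ + z • u, 0, q) ∈ Γ}
  zero_mem' := ⟨0, 0, by simpa only [smul_zero, add_zero] using! Γ.zero_mem⟩
  add_mem' := by
    rintro φ ψ ⟨u, q, h⟩ ⟨v, r, h'⟩
    refine ⟨u + v, q + r, ?_⟩
    convert Γ.add_mem h h' using 1
    simp only [Prod.mk_add_mk, smul_add, add_zero, Prod.mk.injEq, and_true, true_and]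
    abel
  smul_mem' := by
    rintro k φ ⟨u, q, h⟩
    refine ⟨k • u, k • q, ?_⟩
    convert Γ.smul_mem k h using 1
    simp only [Prod.smul_mk, smul_add, smul_zero, smul_comm k z u]

variable [CompleteSpace K]

lemma isClosed_range (h : IsBoundaryTriple Γ E F) {z : ℂ} (hz : z.im ≠ 0) :
    IsClosed (range Γ z : Set K) := by
  have hz' : 0 < |z.im| := abs_pos.2 hz
  refine IsSeqClosed.isClosed fun φ ψ hφ hlim => ?_
  choose u q hu using hφ
  have hcau : CauchySeq u := by
    rw [Metric.cauchySeq_iff']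
    intro ε hε
    obtain ⟨N, hN⟩ := Metric.cauchySeq_iff'.1 hlim.cauchySeq (|z.im| * ε) (by positivity)
    refine ⟨N, fun n hn => ?_⟩
    have h1 : (u n - u N, (φ n - φ N) + z • (u n - u N), (0 : H), q n - q N) ∈ Γ := by
      convert Γ.sub_mem (hu n) (hu N) using 1
      simp only [Prod.mk_sub_mk, smul_sub, sub_zero, Prod.mk.injEq, and_true, true_and]
      abel
    have h2 := h.norm_le h1
    have h3 := hN n hn
    rw [dist_eq_norm] at h3 ⊢
    exact lt_of_mul_lt_mul_left (h2.trans_lt h3) hz'.le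
  obtain ⟨v, hv⟩ := cauchySeq_tendsto_of_complete hcau
  -- the graph of the restriction is closed, being an adjoint
  obtain ⟨r, hr⟩ := h.maximal v (ψ + z • v) fun u' w' q' h' => by
    have h1 : ∀ n, ⟪u n, w'⟫_ℂ = ⟪φ n + z • u n, u'⟫_ℂ := fun n => by
      have := h.green (hu n) h'
      simp only [inner_zero_right, inner_zero_left, sub_self] at this
      exact (sub_eq_zero.1 this).symm
    have l1 : Tendsto (fun n => ⟪u n, w'⟫_ℂ) atTop (𝓝 ⟪v, w'⟫_ℂ) := hv.inner tendsto_const_nhds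
    have l2 : Tendsto (fun n => ⟪φ n + z • u n, u'⟫_ℂ) atTop (𝓝 ⟪ψ + z • v, u'⟫_ℂ) :=
      (hlim.add (hv.const_smul z)).inner tendsto_const_nhds
    simp_rw [h1] at l1
    exact tendsto_nhds_unique l1 l2
  exact ⟨v, r, hr⟩

/-- Self-adjointness: `T - z` is onto for nonreal `z`. -/
lemma range_eq_top (h : IsBoundaryTriple Γ E F) {z : ℂ} (hz : z.im ≠ 0) : range Γ z = ⊤ := by
  have : CompleteSpace (range Γ z) := (h.isClosed_range hz).completeSpace_coe
  rw [← Submodule.orthogonal_eq_bot_iff, Submodule.eq_bot_iff]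
  intro ψ hψ
  rw [Submodule.mem_orthogonal'] at hψ
  obtain ⟨r, hr⟩ := h.maximal ψ ((starRingEnd ℂ) z • ψ) fun u w q hu => by
    have h1 := hψ (w - z • u) ⟨u, q, by simpa using hu⟩
    rw [inner_sub_right, inner_smul_right, sub_eq_zero] at h1
    rw [h1, inner_smul_left, Complex.conj_conj]
  exact h.eq_zero (by simpa using hz) hr

/-- The resolvent of the self-adjoint restriction. -/
lemma exists_resolvent (h : IsBoundaryTriple Γ E F) :
    ∃ R : ℂ → K →L[ℂ] K, ∀ z : ℂ, z.im ≠ 0 →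
      ∀ φ, ∃ q, (R z φ, φ + z • R z φ, 0, q) ∈ Γ := by
  have : ∀ z : ℂ, ∃ R : K →L[ℂ] K, z.im ≠ 0 → ∀ φ, ∃ q, (R φ, φ + z • R φ, 0, q) ∈ Γ := by
    intro z
    by_cases hz : z.im = 0
    · exact ⟨0, fun h => absurd hz h⟩
    have hz' : 0 < |z.im| := abs_pos.2 hz
    have hex : ∀ φ, ∃ u q, (u, φ + z • u, 0, q) ∈ Γ := fun φ => by
      have : φ ∈ range Γ z := h.range_eq_top hz ▸ Submodule.mem_top
      exact this
    choose u q hu using hex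
    have huniq : ∀ {v φ q'}, (v, φ + z • v, 0, q') ∈ Γ → v = u φ := by
      intro v φ q' hv
      refine sub_eq_zero.1 (h.eq_zero hz (q := q' - q φ) ?_)
      convert Γ.sub_mem hv (hu φ) using 1
      simp only [Prod.mk_sub_mk, smul_sub, sub_zero, Prod.mk.injEq, and_true, true_and]
      abel
    refine ⟨LinearMap.mkContinuous ⟨⟨u, fun φ ψ => (huniq (q' := q φ + q ψ) ?_).symm⟩,
      fun k φ => (huniq (q' := k • q φ) ?_).symm⟩ (|z.im|⁻¹) fun φ => ?_, fun _ φ => ⟨q φ, hu φ⟩⟩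
    · convert Γ.add_mem (hu φ) (hu ψ) using 1
      simp only [Prod.mk_add_mk, smul_add, add_zero, Prod.mk.injEq, and_true, true_and]
      abel
    · convert Γ.smul_mem k (hu φ) using 1
      simp [Prod.smul_mk, smul_add, smul_comm k z]
    · rw [inv_mul_eq_div, le_div_iff₀' hz']
      exact h.norm_le (hu φ)
  choose R hR using this
  exact ⟨R, hR⟩

lemma differentiableOn_resolvent (h : IsBoundaryTriple Γ E F) {R : ℂ → K →L[ℂ] K}
    (hR : ∀ z : ℂ, z.im ≠ 0 → ∀ φ, ∃ q, (R z φ, φ + z • R z φ, 0, q) ∈ Γ) :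
    DifferentiableOn ℂ R {z : ℂ | z.im ≠ 0} := by
  have hnorm : ∀ z : ℂ, z.im ≠ 0 → ‖R z‖ ≤ |z.im|⁻¹ := by
    intro z hz
    have hz' : 0 < |z.im| := abs_pos.2 hz
    refine ContinuousLinearMap.opNorm_le_bound _ (by positivity) fun φ => ?_
    obtain ⟨q, hq⟩ := hR z hz φ
    rw [inv_mul_eq_div, le_div_iff₀' hz']
    exact h.norm_le hq
  -- the first resolvent identity, from uniqueness
  have hres : ∀ z w : ℂ, z.im ≠ 0 → w.im ≠ 0 → R z - R w = (z - w) • (R z).comp (R w) := by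
    intro z w hz hw
    ext1 φ
    obtain ⟨q, hq⟩ := hR z hz φ
    obtain ⟨q', hq'⟩ := hR w hw φ
    obtain ⟨q'', hq''⟩ := hR z hz (R w φ)
    refine sub_eq_zero.1 (h.eq_zero hz (q := q - q' - (z - w) • q'') ?_)
    convert Γ.sub_mem (Γ.sub_mem hq hq') (Γ.smul_mem (z - w) hq'') using 1
    simp only [Prod.mk_sub_mk, Prod.smul_mk, sub_apply,
      smul_apply, ContinuousLinearMap.comp_apply, sub_zero, smul_zero,
      Prod.mk.injEq, and_true, true_and, smul_sub, smul_add, sub_smul]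
    simp only [smul_smul]
    rw [mul_comm w z]
    abel
  intro w hw
  have hw : w.im ≠ 0 := hw
  have hopen : {z : ℂ | z.im ≠ 0} ∈ 𝓝 w :=
    (isOpen_ne_fun Complex.continuous_im continuous_const).mem_nhds hw
  have hcont : Tendsto R (𝓝 w) (𝓝 (R w)) := by
    rw [tendsto_iff_norm_sub_tendsto_zero]
    have hb : Tendsto (fun z : ℂ => ‖z - w‖ * (|z.im|⁻¹ * |w.im|⁻¹)) (𝓝 w) (𝓝 0) := by
      have h1 : Tendsto (fun z : ℂ => ‖z - w‖) (𝓝 w) (𝓝 0) :=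
        tendsto_iff_norm_sub_tendsto_zero.1 tendsto_id
      have h2 : Tendsto (fun z : ℂ => |z.im|⁻¹ * |w.im|⁻¹) (𝓝 w) (𝓝 (|w.im|⁻¹ * |w.im|⁻¹)) :=
        ((Complex.continuous_im.abs.tendsto w).inv₀ (abs_ne_zero.2 hw)).mul_const _
      simpa using h1.mul h2
    refine squeeze_zero' (Eventually.of_forall fun _ => norm_nonneg _) ?_ hb
    filter_upwards [hopen] with z hz
    rw [hres z w hz hw, norm_smul]
    gcongr
    exact (ContinuousLinearMap.opNorm_comp_le _ _).trans
      (mul_le_mul (hnorm z hz) (hnorm w hw) (norm_nonneg _) (by positivity))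
  have hder : HasDerivAt R ((R w).comp (R w)) w := by
    rw [hasDerivAt_iff_tendsto_slope]
    have h1 : Tendsto (fun z => (R z).comp (R w)) (𝓝[≠] w) (𝓝 ((R w).comp (R w))) :=
      ((continuous_id.clm_comp continuous_const).tendsto (R w)).comp
        (hcont.mono_left nhdsWithin_le_nhds)
    refine h1.congr' ?_
    filter_upwards [nhdsWithin_le_nhds hopen, self_mem_nhdsWithin] with z hz hzw
    rw [slope_def_module, hres z w hz hw, smul_smul, inv_mul_cancel₀ (sub_ne_zero.2 hzw), one_smul]
  exact hder.differentiableAt.differentiableWithinAt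

variable [CompleteSpace H]

/-- The second boundary value of an element of the self-adjoint restriction. -/
lemma snd_boundary_eq (h : IsBoundaryTriple Γ E F) {u w : K} {q : H} (hu : (u, w, 0, q) ∈ Γ) :
    q = ContinuousLinearMap.adjoint E w - ContinuousLinearMap.adjoint F u := by
  refine ext_inner_left ℂ fun k => ?_
  have := h.green (h.lift_mem k) hu
  rw [inner_sub_right, ContinuousLinearMap.adjoint_inner_right,
    ContinuousLinearMap.adjoint_inner_right]
  simp only [inner_zero_right, zero_sub] at this
  rw [← neg_sub, this, neg_neg]

/-- The Weyl function of a boundary triple: with `R` the resolvent of the self-adjoint restriction,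
`M(z) = (F* - z E*) R(z) (F - z E) - E* (F - z E)`. -/
theorem exists_weylFunction (h : IsBoundaryTriple Γ E F) :
    ∃ M : ℂ → H →L[ℂ] H, (∀ z : ℂ, z.im ≠ 0 → ∀ f, ∃ u, (u, z • u, f, M z f) ∈ Γ) ∧
      AnalyticOnNhd ℂ M {z : ℂ | z.im ≠ 0} ∧
      ∀ z : ℂ, z.im ≠ 0 → M z = ContinuousLinearMap.adjoint (M ((starRingEnd ℂ) z)) := by
  obtain ⟨R, hR⟩ := h.exists_resolvent
  set E' := ContinuousLinearMap.adjoint E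
  set F' := ContinuousLinearMap.adjoint F
  let M : ℂ → H →L[ℂ] H := fun z =>
    (F' - z • E').comp ((R z).comp (F - z • E)) - E'.comp (F - z • E)
  have hM : ∀ z : ℂ, z.im ≠ 0 → ∀ f, ∃ u, (u, z • u, f, M z f) ∈ Γ := by
    intro z hz f
    obtain ⟨q, hq⟩ := hR z hz (F f - z • E f)
    refine ⟨E f - R z (F f - z • E f), ?_⟩
    convert Γ.sub_mem (h.lift_mem f) hq using 1
    have hq' := h.snd_boundary_eq hq
    simp only [Prod.mk_sub_mk, Prod.mk.injEq, true_and, sub_zero, zero_sub, hq', smul_sub]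
    refine ⟨by abel, ?_⟩
    simp only [M, E', F', sub_apply, ContinuousLinearMap.comp_apply,
      smul_apply, map_add, map_sub, map_smul, smul_sub]
    abel
  refine ⟨M, hM, ?_, fun z hz => ?_⟩
  · refine DifferentiableOn.analyticOnNhd ?_
      (isOpen_ne_fun Complex.continuous_im continuous_const)
    have hRd := h.differentiableOn_resolvent hR
    have d1 : DifferentiableOn ℂ (fun z : ℂ => F - z • E) {z : ℂ | z.im ≠ 0} :=
      ((differentiable_const F).sub (differentiable_id.smul_const E)).differentiableOn
    have d2 : DifferentiableOn ℂ (fun z : ℂ => F' - z • E') {z : ℂ | z.im ≠ 0} :=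
      ((differentiable_const F').sub (differentiable_id.smul_const E')).differentiableOn
    exact (d2.clm_comp (hRd.clm_comp d1)).sub ((differentiableOn_const E').clm_comp d1)
  · rw [ContinuousLinearMap.eq_adjoint_iff]
    intro f f'
    obtain ⟨u, hu⟩ := hM z hz f
    obtain ⟨v, hv⟩ := hM ((starRingEnd ℂ) z) (by simpa using hz) f'
    have := h.green hu hv
    rw [inner_smul_left, inner_smul_right, sub_self] at this
    exact sub_eq_zero.1 this.symm

end IsBoundaryTriple

end BoundaryTriple

/-! ### The operators `cos α` and `sin α` -/

section Trig

variable {H : Type*} [NormedAddCommGroup H] [InnerProductSpace ℂ H] [CompleteSpace H]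
  {α : H →L[ℂ] H}

lemma inner_cosOp (α : H →L[ℂ] H) (x y : H) :
    inner ℂ (cosOp α x) y = inner ℂ x (cosOp α y) :=
  (ContinuousLinearMap.isSelfAdjoint_iff_isSymmetric.1 (cfc_predicate Real.cos α)) x y

lemma inner_sinOp (α : H →L[ℂ] H) (x y : H) :
    inner ℂ (sinOp α x) y = inner ℂ x (sinOp α y) :=
  (ContinuousLinearMap.isSelfAdjoint_iff_isSymmetric.1 (cfc_predicate Real.sin α)) x y

lemma sinOp_cosOp (α : H →L[ℂ] H) (x : H) : sinOp α (cosOp α x) = cosOp α (sinOp α x) :=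
  DFunLike.congr_fun (cfc_commute_cfc Real.sin Real.cos α).eq x

lemma cosOp_sq_add_sinOp_sq (hα : IsSelfAdjoint α) (x : H) :
    cosOp α (cosOp α x) + sinOp α (sinOp α x) = x := by
  have h : cosOp α * cosOp α + sinOp α * sinOp α = 1 := by
    rw [cosOp, sinOp, ← cfc_mul .., ← cfc_mul .., ← cfc_add ..]
    rw [← cfc_one ℝ α]
    refine cfc_congr fun t _ => ?_
    simp only [Pi.one_apply]
    rw [← sq, ← sq, Real.cos_sq_add_sin_sq]
  exact DFunLike.congr_fun h x

/-- `(f, g)` are the boundary values of the boundary data `(cos α f - sin α g, sin α f + cos α g)`. -/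
lemma rotate_rotate_symm (hα : IsSelfAdjoint α) (f g : H) :
    cosOp α (cosOp α f - sinOp α g) + sinOp α (sinOp α f + cosOp α g) = f ∧
      -sinOp α (cosOp α f - sinOp α g) + cosOp α (sinOp α f + cosOp α g) = g := by
  constructor
  · nth_rewrite 3 [← cosOp_sq_add_sinOp_sq hα f]
    simp only [map_sub, map_add, sinOp_cosOp]
    abel
  · nth_rewrite 3 [← cosOp_sq_add_sinOp_sq hα g]
    simp only [map_sub, map_add, sinOp_cosOp]
    abel

lemma rotate_symm_rotate (hα : IsSelfAdjoint α) (p q : H) :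
    cosOp α (cosOp α p + sinOp α q) - sinOp α (-sinOp α p + cosOp α q) = p ∧
      sinOp α (cosOp α p + sinOp α q) + cosOp α (-sinOp α p + cosOp α q) = q := by
  constructor
  · nth_rewrite 3 [← cosOp_sq_add_sinOp_sq hα p]
    simp only [map_add, map_neg, sinOp_cosOp]
    abel
  · nth_rewrite 3 [← cosOp_sq_add_sinOp_sq hα q]
    simp only [map_add, map_neg, sinOp_cosOp]
    abel

/-- The rotation by `α` preserves the symplectic form of boundary data. -/
lemma inner_rotate (hα : IsSelfAdjoint α) (f g f' g' : H) :
    inner ℂ (sinOp α f + cosOp α g) (cosOp α f' - sinOp α g') -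
      inner ℂ (cosOp α f - sinOp α g) (sinOp α f' + cosOp α g') = inner ℂ g f' - inner ℂ f g' := by
  have h1 := congrArg (inner ℂ g) (cosOp_sq_add_sinOp_sq hα f')
  have h2 := congrArg (inner ℂ f) (cosOp_sq_add_sinOp_sq hα g')
  simp only [inner_add_right] at h1 h2
  simp only [inner_add_left, inner_sub_left, inner_add_right, inner_sub_right, inner_cosOp,
    inner_sinOp, sinOp_cosOp]
  rw [← h1, ← h2]
  ring

end Trig

/-! ### The interval and its Lebesgue measure -/

section Interval

variable {a : ℝ} {b : EReal}

instance ordConnected_openInterval : (openInterval a b).OrdConnected :=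
  ⟨fun _ hx _ hy _ hz => ⟨hx.1.trans_le hz.1, (EReal.coe_le_coe_iff.2 hz.2).trans_lt hy.2⟩⟩

instance ordConnected_halfOpenInterval : (halfOpenInterval a b).OrdConnected :=
  ⟨fun _ hx _ hy _ hz => ⟨hx.1.trans hz.1, (EReal.coe_le_coe_iff.2 hz.2).trans_lt hy.2⟩⟩

lemma openInterval_subset : openInterval a b ⊆ halfOpenInterval a b := fun _ hx => ⟨hx.1.le, hx.2⟩

lemma left_mem (hab : (a : EReal) < b) : a ∈ halfOpenInterval a b := ⟨le_rfl, hab⟩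

lemma isOpen_openInterval : IsOpen (openInterval a b) :=
  (isOpen_lt continuous_const continuous_id).inter
    (isOpen_lt continuous_coe_real_ereal continuous_const)

lemma measurableSet_openInterval : MeasurableSet (openInterval a b) :=
  isOpen_openInterval.measurableSet

lemma uIoc_subset_openInterval {c d : ℝ} (hc : c ∈ halfOpenInterval a b)
    (hd : d ∈ halfOpenInterval a b) : uIoc c d ⊆ openInterval a b := by
  intro x hx
  have h1 := ordConnected_halfOpenInterval.uIcc_subset hc hd (uIoc_subset_uIcc hx)
  exact ⟨(le_min hc.1 hd.1).trans_lt hx.1, h1.2⟩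

lemma ae_intervalMeasure_iff {P : ℝ → Prop} :
    (∀ᵐ x ∂(intervalMeasure a b), P x) ↔ ∀ᵐ x, x ∈ openInterval a b → P x :=
  ae_restrict_iff' measurableSet_openInterval

lemma ae_halfOpenInterval {P : ℝ → Prop} (h : ∀ᵐ x ∂(intervalMeasure a b), P x) :
    ∀ᵐ x, x ∈ halfOpenInterval a b → P x := by
  filter_upwards [ae_intervalMeasure_iff.1 h,
    measure_eq_zero_iff_ae_notMem.1 (measure_singleton a : volume {a} = 0)] with x hx hxa hI
  exact hx ⟨lt_of_le_of_ne hI.1 (Ne.symm hxa), hI.2⟩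

lemma exists_mem_openInterval {c : ℝ} (hc : c ∈ halfOpenInterval a b) :
    ∃ d ∈ openInterval a b, c < d := by
  obtain ⟨d, h1, h2⟩ := EReal.lt_iff_exists_real_btwn.1 hc.2
  have h3 : c < d := EReal.coe_lt_coe_iff.1 h1
  exact ⟨d, ⟨hc.1.trans_lt h3, h2⟩, h3⟩

/-- The interval is exhausted by the intervals `(a, x n]` for a monotone sequence `x n ↑ b`. -/
lemma exists_exhaustion (hab : (a : EReal) < b) :
    ∃ x : ℕ → ℝ, Monotone x ∧ (∀ n, x n ∈ openInterval a b) ∧ Tendsto x atTop (leftOf b) ∧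
      ⋃ n, Ioc a (x n) = openInterval a b := by
  obtain ⟨u, hmono, hmem, hlim⟩ := exists_seq_strictMono_tendsto' hab
  have hu : ∀ n, ∃ x : ℝ, (x : EReal) = u n := fun n =>
    ⟨(u n).toReal, EReal.coe_toReal ((hmem n).2.trans_le le_top).ne
      (bot_lt_iff_ne_bot.1 ((EReal.bot_lt_coe a).trans (hmem n).1))⟩
  choose x hx using hu
  have hxI : ∀ n, x n ∈ openInterval a b := fun n =>
    ⟨EReal.coe_lt_coe_iff.1 (by rw [hx]; exact (hmem n).1), by rw [hx]; exact (hmem n).2⟩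
  refine ⟨x, fun m n h => EReal.coe_le_coe_iff.1 ?_, hxI, ?_, ?_⟩
  · rw [hx, hx]; exact hmono.monotone h
  · rw [leftOf, tendsto_comap_iff]
    have : (fun x : ℝ => (x : EReal)) ∘ x = u := funext hx
    rw [this]
    exact tendsto_nhdsWithin_iff.2 ⟨hlim, Eventually.of_forall fun n => (hmem n).2⟩
  · ext t
    simp only [mem_iUnion]
    constructor
    · rintro ⟨n, h1, h2⟩
      exact ⟨h1, (EReal.coe_le_coe_iff.2 h2).trans_lt (hxI n).2⟩
    · rintro ⟨h1, h2⟩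
      obtain ⟨n, hn⟩ := (hlim.eventually (lt_mem_nhds h2)).exists
      refine ⟨n, h1, EReal.coe_le_coe_iff.1 ?_⟩
      rw [hx]; exact hn.le

end Interval

/-! ### Coefficients and square-integrable functions on compact subintervals -/

section Local

variable {H : Type*} [NormedAddCommGroup H] [InnerProductSpace ℂ H] {a : ℝ} {b : EReal}

lemma L2.intervalIntegrable (w : L2 H a b) {c d : ℝ} (hc : c ∈ halfOpenInterval a b)
    (hd : d ∈ halfOpenInterval a b) : IntervalIntegrable w volume c d := by
  rw [intervalIntegrable_iff]
  have h := (Lp.memLp w).mono_measure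
    (Measure.restrict_mono (uIoc_subset_openInterval hc hd) (le_refl (volume : Measure ℝ)))
  have : IsFiniteMeasure (volume.restrict (uIoc c d)) := ⟨by
    rw [Measure.restrict_apply_univ, uIoc]; exact measure_Ioc_lt_top⟩
  exact h.integrable one_le_two

lemma L2.inner_eq (u w : L2 H a b) {y v : ℝ → H} (hu : u =ᵐ[intervalMeasure a b] y)
    (hw : w =ᵐ[intervalMeasure a b] v) :
    Integrable (fun x => inner ℂ (y x) (v x)) (intervalMeasure a b) ∧
      inner ℂ u w = ∫ x, inner ℂ (y x) (v x) ∂(intervalMeasure a b) := by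
  have h : (fun x => inner ℂ (u x) (w x)) =ᵐ[intervalMeasure a b] fun x => inner ℂ (y x) (v x) := by
    filter_upwards [hu, hw] with x h1 h2
    rw [h1, h2]
  exact ⟨(L2.integrable_inner (𝕜 := ℂ) u w).congr h, by rw [L2.inner_def]; exact integral_congr_ae h⟩

/-- A function on `(a, b)` that is bounded and measurable on `(a, d]` and zero beyond `d` is square
integrable. -/
lemma memLp_of_bounded {E : Type*} [NormedAddCommGroup E] {f : ℝ → E} {d C : ℝ}
    (hm : AEStronglyMeasurable f (volume.restrict (Ioc a d)))
    (hC : ∀ x ∈ Ioc a d, ‖f x‖ ≤ C) (h0 : ∀ x, d < x → f x = 0) :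
    MemLp f 2 (intervalMeasure a b) ∧ eLpNorm f 2 (intervalMeasure a b) ≤
      (volume (Ioc a d)) ^ (2⁻¹ : ℝ) * ENNReal.ofReal C := by
  have hind : f =ᵐ[intervalMeasure a b] (Ioc a d).indicator f := by
    refine ae_intervalMeasure_iff.2 (ae_of_all _ fun x hx => ?_)
    by_cases hxd : x ≤ d
    · rw [indicator_of_mem (show x ∈ Ioc a d from ⟨hx.1, hxd⟩)]
    · rw [indicator_of_notMem (fun h => hxd h.2), h0 x (not_le.1 hxd)]
  have hle : eLpNorm f 2 (intervalMeasure a b) ≤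
      (volume (Ioc a d)) ^ (2⁻¹ : ℝ) * ENNReal.ofReal C := by
    rw [eLpNorm_congr_ae hind, eLpNorm_indicator_eq_eLpNorm_restrict measurableSet_Ioc]
    have h1 : eLpNorm f 2 ((intervalMeasure a b).restrict (Ioc a d)) ≤
        eLpNorm f 2 (volume.restrict (Ioc a d)) :=
      eLpNorm_mono_measure _ (Measure.restrict_mono subset_rfl Measure.restrict_le_self)
    refine h1.trans ?_
    have h2 := eLpNorm_le_of_ae_bound (p := 2) (f := f) (μ := volume.restrict (Ioc a d)) (C := C)
      ((ae_restrict_iff' measurableSet_Ioc).2 (ae_of_all _ hC))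
    simpa using h2
  refine ⟨⟨?_, hle.trans_lt ?_⟩, hle⟩
  · refine AEStronglyMeasurable.congr ?_ hind.symm
    rw [aestronglyMeasurable_indicator_iff measurableSet_Ioc]
    exact hm.mono_measure (Measure.restrict_mono subset_rfl Measure.restrict_le_self)
  · exact ENNReal.mul_lt_top (ENNReal.rpow_lt_top_of_nonneg (by norm_num) measure_Ioc_lt_top.ne)
      ENNReal.ofReal_lt_top

/-- A bounded, strongly measurable, operator-valued function that vanishes beyond `d` defines a
bounded operator into `L²`. -/
lemma exists_clm_L2 {T : ℝ → H →L[ℂ] H} {d C : ℝ} (hC0 : 0 ≤ C)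
    (hm : ∀ h, AEStronglyMeasurable (fun x => T x h) (volume.restrict (Ioc a d)))
    (hC : ∀ x ∈ Ioc a d, ‖T x‖ ≤ C) (h0 : ∀ x, d < x → T x = 0) :
    ∃ E : H →L[ℂ] L2 H a b, ∀ h, E h =ᵐ[intervalMeasure a b] fun x => T x h := by
  have hb : ∀ h, ∀ x ∈ Ioc a d, ‖T x h‖ ≤ C * ‖h‖ := fun h x hx =>
    (T x).le_of_opNorm_le (hC x hx) h
  have hp := fun h => memLp_of_bounded (b := b) (hm h) (hb h) fun x hx => by rw [h0 x hx]; rfl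
  let E : H →ₗ[ℂ] L2 H a b :=
    { toFun := fun h => (hp h).1.toLp
      map_add' := fun h k => by
        rw [← MemLp.toLp_add]
        exact MemLp.toLp_congr _ _ (ae_of_all _ fun x => map_add (T x) h k)
      map_smul' := fun k h => by
        rw [RingHom.id_apply, ← MemLp.toLp_const_smul]
        exact MemLp.toLp_congr _ _ (ae_of_all _ fun x => map_smul (T x) k h) }
  refine ⟨E.mkContinuous (((volume (Ioc a d)) ^ (2⁻¹ : ℝ)).toReal * C) fun h => ?_,
    fun h => (hp h).1.coeFn_toLp⟩
  change ‖(hp h).1.toLp‖ ≤ _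
  rw [Lp.norm_toLp]
  have := ENNReal.toReal_mono ?_ (hp h).2
  · refine this.trans (le_of_eq ?_)
    rw [ENNReal.toReal_mul, ENNReal.toReal_ofReal (by positivity)]
    ring
  · exact (ENNReal.mul_lt_top (ENNReal.rpow_lt_top_of_nonneg (by norm_num) measure_Ioc_lt_top.ne)
      ENNReal.ofReal_lt_top).ne

variable [CompleteSpace H] {V : ℝ → H →L[ℂ] H}

lemma IsPotential.intervalIntegrable_norm (hV : IsPotential a b V) (ha : IsRegularLeft a b V)
    {c d : ℝ} (hc : c ∈ halfOpenInterval a b) (hd : d ∈ halfOpenInterval a b) :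
    IntervalIntegrable (fun x => ‖V x‖) volume c d := by
  obtain ⟨e, he, hint⟩ := ha
  have h1 : IntervalIntegrable (fun x => ‖V x‖) volume a e := by
    rw [intervalIntegrable_iff_integrableOn_Ioc_of_le he.1.le]
    exact hint.mono_set Ioc_subset_Icc_self
  have h2 : ∀ x ∈ halfOpenInterval a b, IntervalIntegrable (fun x => ‖V x‖) volume a x := by
    intro x hx
    rcases le_total x e with hxe | hex
    · exact h1.mono_set (uIcc_subset_uIcc_left (by rw [uIcc_of_le he.1.le]; exact ⟨hx.1, hxe⟩))
    · refine h1.trans ?_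
      have hxo : x ∈ openInterval a b := ⟨he.1.trans_le hex, hx.2⟩
      rw [intervalIntegrable_iff_integrableOn_Icc_of_le hex]
      exact hV.locallyIntegrable.integrableOn_compact_subset
        (ordConnected_openInterval.out he hxo) isCompact_Icc
  exact (h2 c hc).symm.trans (h2 d hd)

variable [TopologicalSpace.SeparableSpace H]

/-- The coefficient `V - z` of `τ y = z y`, written as `y'' = (V - z) y`. -/
lemma IsPotential.isCoeff (hV : IsPotential a b V) (ha : IsRegularLeft a b V) (z : ℂ) :
    IsCoeff (halfOpenInterval a b) (fun x => V x - z • ContinuousLinearMap.id ℂ H)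
      (fun x => ‖V x‖ + ‖z • ContinuousLinearMap.id ℂ H‖) where
  norm_le x := norm_sub_le _ _
  integrable c hc d hd := (hV.intervalIntegrable_norm ha hc hd).add intervalIntegrable_const
  measurable h c hc d hd := by
    have := (aestronglyMeasurable_of_inner fun g => hV.weaklyMeasurable g h).mono_measure
      (Measure.restrict_mono (uIoc_subset_openInterval hc hd) (le_refl (volume : Measure ℝ)))
    exact this.sub aestronglyMeasurable_const

end Local

/-! ### The boundary triple of the maximal operator -/

section Triple

variable {H : Type*} [NormedAddCommGroup H] [InnerProductSpace ℂ H] [CompleteSpace H]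
  {a : ℝ} {b : EReal} {V : ℝ → H →L[ℂ] H}

/-- Green's identity on `[a, d]` for the expression `τ = -d²/dx² + V`. -/
lemma green_compact (hab : (a : EReal) < b)
    (hsa : ∀ᵐ x ∂(intervalMeasure a b), IsSelfAdjoint (V x)) {y y₁ y₂ v v₁ v₂ w w' : ℝ → H}
    (hy : IsW21Loc (halfOpenInterval a b) y y₁ y₂) (hv : IsW21Loc (halfOpenInterval a b) v v₁ v₂)
    (hw : w =ᵐ[intervalMeasure a b] fun x => -y₂ x + V x (y x))
    (hw' : w' =ᵐ[intervalMeasure a b] fun x => -v₂ x + V x (v x)) {d : ℝ}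
    (hd : d ∈ halfOpenInterval a b) :
    (inner ℂ (y d) (v₁ d) - inner ℂ (y₁ d) (v d)) - (inner ℂ (y a) (v₁ a) - inner ℂ (y₁ a) (v a)) =
      ∫ t in a..d, (inner ℂ (w t) (v t) - inner ℂ (y t) (w' t)) := by
  rw [hy.green hv (left_mem hab) hd]
  refine intervalIntegral.integral_congr_ae ?_
  filter_upwards [ae_intervalMeasure_iff.1 hsa, ae_intervalMeasure_iff.1 hw,
    ae_intervalMeasure_iff.1 hw'] with x h1 h2 h3 hx
  have hxI := uIoc_subset_openInterval (left_mem hab) hd hx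
  rw [h2 hxI, h3 hxI, inner_add_left, inner_add_right, inner_neg_left, inner_neg_right]
  have := (ContinuousLinearMap.isSelfAdjoint_iff_isSymmetric.1 (h1 hxI)) (y x) (v x)
  simp only [ContinuousLinearMap.coe_coe] at this
  rw [this]
  ring

/-- Green's identity on `(a, b)`: by the limit-point hypothesis there is no contribution at `b`. -/
lemma green_limitPoint (hab : (a : EReal) < b) (hV : IsPotential a b V)
    (hb : IsLimitPointRight a b V) {u w u' w' : L2 H a b} {y y₁ y₂ v v₁ v₂ : ℝ → H}
    (hy : IsW21Loc (halfOpenInterval a b) y y₁ y₂) (hv : IsW21Loc (halfOpenInterval a b) v v₁ v₂)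
    (hu : u =ᵐ[intervalMeasure a b] y) (hu' : u' =ᵐ[intervalMeasure a b] v)
    (hw : w =ᵐ[intervalMeasure a b] fun x => -y₂ x + V x (y x))
    (hw' : w' =ᵐ[intervalMeasure a b] fun x => -v₂ x + V x (v x)) :
    inner ℂ w u' - inner ℂ u w' = inner ℂ (y₁ a) (v a) - inner ℂ (y a) (v₁ a) := by
  obtain ⟨i1, e1⟩ := L2.inner_eq w u' (ae_eq_refl _) hu'
  obtain ⟨i2, e2⟩ := L2.inner_eq u w' hu (ae_eq_refl _)
  obtain ⟨x, hmono, hmem, hlim, hun⟩ := exists_exhaustion hab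
  rw [e1, e2, ← integral_sub i1 i2]
  have l1 := (hb u w u' w' y y₁ v v₁ ⟨y₂, hy.mono openInterval_subset, hu, hw⟩
    ⟨v₂, hv.mono openInterval_subset, hu', hw'⟩).comp hlim
  have l2 : Tendsto (fun n => ∫ t in Ioc a (x n), (inner ℂ (w t) (v t) - inner ℂ (y t) (w' t)))
      atTop (𝓝 (∫ t in ⋃ n, Ioc a (x n), (inner ℂ (w t) (v t) - inner ℂ (y t) (w' t)))) := by
    refine tendsto_setIntegral_of_monotone (fun n => measurableSet_Ioc)
      (fun m n h => Ioc_subset_Ioc_right (hmono h)) ?_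
    rw [hun]
    exact i1.sub i2
  rw [hun] at l2
  have l3 : Tendsto (fun n => ∫ t in Ioc a (x n), (inner ℂ (w t) (v t) - inner ℂ (y t) (w' t)))
      atTop (𝓝 (0 - (inner ℂ (y a) (v₁ a) - inner ℂ (y₁ a) (v a)))) := by
    refine (l1.sub_const _).congr fun n => ?_
    rw [← intervalIntegral.integral_of_le (hmem n).1.le]
    exact green_compact hab hV.selfAdjoint hy hv hw hw' (openInterval_subset (hmem n))
  exact (tendsto_nhds_unique l2 l3).trans (by ring)

/-- The boundary triple of `τ` in graph form: the quadruples `(u, τ u, f, g)` for `u` in the maximal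
domain, where `f = cos α u(a) + sin α u'(a)` and `g = -sin α u(a) + cos α u'(a)`. The boundary
values are encoded by the inverse rotation, and `u` by its `C¹` representative on `[a, b)`. -/
def boundaryTriple (a : ℝ) (b : EReal) (V : ℝ → H →L[ℂ] H) (α : H →L[ℂ] H) :
    Submodule ℂ (L2 H a b × L2 H a b × H × H) where
  carrier := {p | ∃ y y₁ y₂ : ℝ → H, IsW21Loc (halfOpenInterval a b) y y₁ y₂ ∧
    p.1 =ᵐ[intervalMeasure a b] y ∧
    p.2.1 =ᵐ[intervalMeasure a b] (fun x => -y₂ x + V x (y x)) ∧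
    y a = cosOp α p.2.2.1 - sinOp α p.2.2.2 ∧ y₁ a = sinOp α p.2.2.1 + cosOp α p.2.2.2}
  zero_mem' := by
    refine ⟨0, 0, 0, IsW21Loc.zero _, Lp.coeFn_zero _ _ _, ?_, by simp, by simp⟩
    filter_upwards [Lp.coeFn_zero H 2 (intervalMeasure a b)] with x hx
    simpa using hx
  add_mem' := by
    rintro ⟨u, w, f, g⟩ ⟨u', w', f', g'⟩ ⟨y, y₁, y₂, hy, hu, hw, h0, h1⟩
      ⟨v, v₁, v₂, hv, hu', hw', h0', h1'⟩
    refine ⟨y + v, y₁ + v₁, y₂ + v₂, hy.add hv, (Lp.coeFn_add u u').trans (hu.add hu'), ?_, ?_, ?_⟩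
    · filter_upwards [Lp.coeFn_add w w', hw, hw'] with x h h1 h2
      simp only [Prod.mk_add_mk, h, Pi.add_apply, h1, h2, map_add]
      abel
    · simp only [Pi.add_apply, h0, h0', Prod.mk_add_mk, map_add]
      abel
    · simp only [Pi.add_apply, h1, h1', Prod.mk_add_mk, map_add]
      abel
  smul_mem' := by
    rintro k ⟨u, w, f, g⟩ ⟨y, y₁, y₂, hy, hu, hw, h0, h1⟩
    refine ⟨k • y, k • y₁, k • y₂, hy.smul k, (Lp.coeFn_smul k u).trans (hu.const_smul k),
      ?_, ?_, ?_⟩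
    · filter_upwards [Lp.coeFn_smul k w, hw] with x h h1
      simp only [Prod.smul_mk, h, Pi.smul_apply, h1, map_smul, smul_add, smul_neg]
    · simp only [Pi.smul_apply, h0, Prod.smul_mk, map_smul, smul_sub]
    · simp only [Pi.smul_apply, h1, Prod.smul_mk, map_smul, smul_add]

lemma mem_boundaryTriple {α : H →L[ℂ] H} {u w : L2 H a b} {f g : H} :
    (u, w, f, g) ∈ boundaryTriple a b V α ↔
      ∃ y y₁ y₂ : ℝ → H, IsW21Loc (halfOpenInterval a b) y y₁ y₂ ∧
        u =ᵐ[intervalMeasure a b] y ∧ w =ᵐ[intervalMeasure a b] (fun x => -y₂ x + V x (y x)) ∧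
        y a = cosOp α f - sinOp α g ∧ y₁ a = sinOp α f + cosOp α g := Iff.rfl

lemma boundaryTriple_green (hab : (a : EReal) < b) (hV : IsPotential a b V)
    (hb : IsLimitPointRight a b V) {α : H →L[ℂ] H} (hα : IsSelfAdjoint α)
    {u w u' w' : L2 H a b} {f g f' g' : H} (h : (u, w, f, g) ∈ boundaryTriple a b V α)
    (h' : (u', w', f', g') ∈ boundaryTriple a b V α) :
    inner ℂ w u' - inner ℂ u w' = inner ℂ g f' - inner ℂ f g' := by
  obtain ⟨y, y₁, y₂, hy, hu, hw, h0, h1⟩ := mem_boundaryTriple.1 h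
  obtain ⟨v, v₁, v₂, hv, hu', hw', h0', h1'⟩ := mem_boundaryTriple.1 h'
  rw [green_limitPoint hab hV hb hy hv hu hu' hw hw', h0, h1, h0', h1', inner_rotate hα]

/-! ### A bounded lift of boundary values -/

/-- Cut-off functions near `a`, together with their first two derivatives. -/
lemma exists_cutoff {a d : ℝ} (had : a < d) : ∃ χ χ₁ χ₂ : ℝ → ℝ,
    (∀ x, HasDerivAt χ (χ₁ x) x) ∧ (∀ x, HasDerivAt χ₁ (χ₂ x) x) ∧ Continuous χ₂ ∧
    χ a = 1 ∧ χ₁ a = 0 ∧ ∀ x, d ≤ x → χ x = 0 ∧ χ₁ x = 0 ∧ χ₂ x = 0 := by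
  let f : ContDiffBump a := ⟨(d - a) / 3, (d - a) / 2, by linarith, by linarith⟩
  have hf : ContDiff ℝ 2 f := f.contDiff
  have hf1 : ContDiff ℝ 1 (deriv f) := by
    have : ContDiff ℝ (1 + 1) f := by rw [one_add_one_eq_two]; exact hf
    exact (contDiff_succ_iff_deriv.1 this).2.2
  refine ⟨f, deriv f, deriv (deriv f), fun x => ?_, fun x => ?_, ?_, ?_, ?_, fun x hx => ?_⟩
  · exact (hf.differentiable (by norm_num) x).hasDerivAt
  · exact (hf1.differentiable (by norm_num) x).hasDerivAt
  · exact hf1.continuous_deriv le_rfl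
  · exact f.eventuallyEq_one.eq_of_nhds
  · rw [f.eventuallyEq_one.deriv_eq]
    exact deriv_const a (1 : ℝ)
  · have h0 : (f : ℝ → ℝ) =ᶠ[𝓝 x] fun _ => 0 := by
      filter_upwards [lt_mem_nhds (show a + (d - a) / 2 < x by linarith)] with t ht
      refine f.zero_of_le_dist ?_
      rw [Real.dist_eq, abs_of_nonneg (by linarith)]
      change (d - a) / 2 ≤ t - a
      linarith
    have h1 : deriv f =ᶠ[𝓝 x] fun _ => 0 := by
      simpa using h0.deriv
    have h2 : deriv (deriv f) =ᶠ[𝓝 x] fun _ => 0 := by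
      simpa using h1.deriv
    exact ⟨h0.eq_of_nhds, h1.eq_of_nhds, h2.eq_of_nhds⟩

end Triple

section Lift

variable {H : Type*} [NormedAddCommGroup H] [InnerProductSpace ℂ H] [CompleteSpace H]
  [TopologicalSpace.SeparableSpace H] {a : ℝ} {b : EReal} {V : ℝ → H →L[ℂ] H} {α : H →L[ℂ] H}

/-- The coefficient of the equation `τ y = 0`. -/
lemma IsPotential.isCoeff_zero (hV : IsPotential a b V) (ha : IsRegularLeft a b V) :
    IsCoeff (halfOpenInterval a b) V (fun x => ‖V x‖) := by
  simpa using hV.isCoeff ha 0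

/-- The lift of boundary values: `E h` is the solution of `τ y = 0` with boundary values `(h, 0)`,
multiplied by a smooth cut-off function near `a`. The product rule shows that `τ (E h)` does not
involve `V`, so that it is square integrable. -/
lemma exists_lift (hab : (a : EReal) < b) (hV : IsPotential a b V) (ha : IsRegularLeft a b V) :
    ∃ E F : H →L[ℂ] L2 H a b, ∀ h, (E h, F h, h, 0) ∈ boundaryTriple a b V α := by
  have haI := left_mem hab
  obtain ⟨d, hd, had⟩ := exists_mem_openInterval haI
  have hdI := openInterval_subset hd
  have hQ := hV.isCoeff_zero ha
  obtain ⟨S, S₁, hS, hS0, hSb⟩ := hQ.exists_fundamental haI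
  obtain ⟨χ, χ₁, χ₂, h1, h2, h3, hχa, hχ₁a, hχd⟩ := exists_cutoff had
  have hc : Continuous χ := continuous_iff_continuousAt.2 fun x => (h1 x).continuousAt
  have hc1 : Continuous χ₁ := continuous_iff_continuousAt.2 fun x => (h2 x).continuousAt
  obtain ⟨N, hN⟩ := (isCompact_Icc (a := a) (b := d)).exists_bound_of_continuousOn hc.continuousOn
  obtain ⟨N₁, hN₁⟩ := (isCompact_Icc (a := a) (b := d)).exists_bound_of_continuousOn
    hc1.continuousOn
  obtain ⟨N₂, hN₂⟩ := (isCompact_Icc (a := a) (b := d)).exists_bound_of_continuousOn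
    h3.continuousOn
  obtain ⟨M, hM⟩ : ∃ M, ∀ x ∈ Ioc a d, ‖S x‖ ≤ M ∧ ‖S₁ x‖ ≤ M := by
    have hint := hQ.isLinearCoeff.integrable a haI d hdI
    obtain ⟨Λ, hΛ⟩ := isCompact_uIcc.exists_bound_of_continuousOn
      (intervalIntegral.continuousOn_primitive_interval' hint left_mem_uIcc)
    refine ⟨Real.exp Λ, fun x hx => ?_⟩
    have hx' : x ∈ uIcc a d := by rw [uIcc_of_le had.le]; exact Ioc_subset_Icc_self hx
    have h4 := hSb x (ordConnected_halfOpenInterval.uIcc_subset haI hdI hx')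
    have h5 : Real.exp |∫ s in a..x, (1 + ‖V s‖)| ≤ Real.exp Λ := Real.exp_le_exp.2 (hΛ x hx')
    exact ⟨h4.1.trans h5, h4.2.trans h5⟩
  have hM0 : 0 ≤ M := (norm_nonneg (S d)).trans (hM d ⟨had, le_rfl⟩).1
  have hN0 : 0 ≤ N := (norm_nonneg _).trans (hN a ⟨le_rfl, had.le⟩)
  have hN₁0 : 0 ≤ N₁ := (norm_nonneg _).trans (hN₁ a ⟨le_rfl, had.le⟩)
  have hN₂0 : 0 ≤ N₂ := (norm_nonneg _).trans (hN₂ a ⟨le_rfl, had.le⟩)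
  have hsub : Ioc a d ⊆ uIcc a d := by rw [uIcc_of_le had.le]; exact Ioc_subset_Icc_self
  have mS : ∀ ξ, AEStronglyMeasurable (fun x => S x ξ) (volume.restrict (Ioc a d)) := fun ξ =>
    (((hS ξ).continuousOn haI hdI).mono hsub).aestronglyMeasurable measurableSet_Ioc
  have mS₁ : ∀ ξ, AEStronglyMeasurable (fun x => S₁ x ξ) (volume.restrict (Ioc a d)) := fun ξ =>
    (((hS ξ).continuousOn_deriv haI hdI).mono hsub).aestronglyMeasurable measurableSet_Ioc
  let ι : H →L[ℂ] H × H := (cosOp α).prod (sinOp α)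
  obtain ⟨E, hE⟩ := exists_clm_L2 (b := b) (T := fun x => ((χ x : ℝ) : ℂ) • (S x).comp ι)
    (d := d) (C := N * (M * ‖ι‖)) (by positivity)
    (fun h => (Complex.continuous_ofReal.comp hc).aestronglyMeasurable.smul (mS (ι h)))
    (fun x hx => by
      rw [norm_smul, Complex.norm_real]
      have := hN x (Ioc_subset_Icc_self hx)
      have := (hM x hx).1
      have := (S x).opNorm_comp_le ι
      gcongr
      exact this.trans (by gcongr))
    (fun x hx => by simp [(hχd x hx.le).1])
  obtain ⟨F, hF⟩ := exists_clm_L2 (b := b)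
    (T := fun x => -(((2 * χ₁ x : ℝ) : ℂ) • (S₁ x).comp ι + ((χ₂ x : ℝ) : ℂ) • (S x).comp ι))
    (d := d) (C := 2 * N₁ * (M * ‖ι‖) + N₂ * (M * ‖ι‖)) (by positivity)
    (fun h => (((Complex.continuous_ofReal.comp (hc1.const_mul 2)).aestronglyMeasurable.smul
      (mS₁ (ι h))).add ((Complex.continuous_ofReal.comp h3).aestronglyMeasurable.smul
      (mS (ι h)))).neg)
    (fun x hx => by
      rw [norm_neg]
      refine (norm_add_le _ _).trans ?_
      rw [norm_smul, norm_smul, Complex.norm_real, Complex.norm_real, norm_mul, Real.norm_ofNat]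
      have := hN₁ x (Ioc_subset_Icc_self hx)
      have := hN₂ x (Ioc_subset_Icc_self hx)
      obtain ⟨h4, h5⟩ := hM x hx
      have := (S x).opNorm_comp_le ι
      have := (S₁ x).opNorm_comp_le ι
      gcongr
      · exact this.trans (by gcongr)
      · exact (S x).opNorm_comp_le ι |>.trans (by gcongr))
    (fun x hx => by simp [(hχd x hx.le).2.1, (hχd x hx.le).2.2])
  refine ⟨E, F, fun h => mem_boundaryTriple.2 ⟨_, _, _, (hS (ι h)).smooth_smul h1 h2 h3, ?_, ?_,
    ?_, ?_⟩⟩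
  · filter_upwards [hE h] with x hx
    rw [hx]
    simp
  · filter_upwards [hF h] with x hx
    rw [hx]
    simp only [neg_apply, add_apply, smul_apply, ContinuousLinearMap.comp_apply, Complex.coe_smul,
      mul_smul, (V x).map_smul_of_tower (χ x)]
    abel
  · simp [hχa, hS0, ι]
  · simp [hχa, hχ₁a, hS0, ι]

/-! ### Maximality of the boundary triple -/

/-- Maximality: if `(g, k)` is orthogonal in the sense of Green's identity to all elements with
vanishing first boundary value, then `g` agrees with the solution `p` of `τ p = k` whose boundary
values `(0, h)` are read off from the lift. On `(a, d)` this follows by testing with the solution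
of `τ u = g - p` that vanishes beyond `d`, corrected by the lift of its first boundary value. -/
lemma boundaryTriple_maximal (hab : (a : EReal) < b) (hV : IsPotential a b V)
    (ha : IsRegularLeft a b V) (hα : IsSelfAdjoint α) {E F : H →L[ℂ] L2 H a b}
    (hEF : ∀ h, (E h, F h, h, 0) ∈ boundaryTriple a b V α) (g k : L2 H a b)
    (hgk : ∀ u w q, (u, w, 0, q) ∈ boundaryTriple a b V α → inner ℂ g w = inner ℂ k u) :
    ∃ h, (g, k, 0, h) ∈ boundaryTriple a b V α := by
  have haI := left_mem hab
  have hQ := hV.isCoeff_zero ha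
  set h : H := ContinuousLinearMap.adjoint E k - ContinuousLinearMap.adjoint F g with hh
  obtain ⟨p, p₁, hp, hp0, hp1, -⟩ := hQ.exists_solution haI (-sinOp α h) (cosOp α h) (w := k)
    fun x hx y hy => L2.intervalIntegrable k hx hy
  have hpk : k =ᵐ[intervalMeasure a b] fun x => -(V x (p x) - k x) + V x (p x) :=
    ae_of_all _ fun x => by simp
  refine ⟨h, mem_boundaryTriple.2 ⟨p, p₁, _, hp, ?_, hpk, by simp [hp0], by simp [hp1]⟩⟩
  have key : ∀ d ∈ openInterval a b, ∀ᵐ x, x ∈ Ioc a d → g x = p x := by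
    intro d hd
    have hdI := openInterval_subset hd
    have hsub : Ioc a d ⊆ openInterval a b := fun x hx =>
      ⟨hx.1, (EReal.coe_le_coe_iff.2 hx.2).trans_lt hd.2⟩
    have hpc : ContinuousOn p (Icc a d) := by
      rw [← uIcc_of_le hd.1.le]; exact hp.continuousOn haI hdI
    -- the test function `1_(a, d] (g - p)`
    have hpL : MemLp ((Ioc a d).indicator p) 2 (intervalMeasure a b) := by
      obtain ⟨C, hC⟩ := isCompact_Icc.exists_bound_of_continuousOn hpc
      refine (memLp_of_bounded (d := d) (C := C) ?_ (fun x hx => ?_) fun x hx => ?_).1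
      · exact ((hpc.mono Ioc_subset_Icc_self).aestronglyMeasurable measurableSet_Ioc).indicator
          measurableSet_Ioc
      · rw [indicator_of_mem hx]; exact hC x (Ioc_subset_Icc_self hx)
      · exact indicator_of_notMem (fun h => not_le.2 hx h.2) _
    have hwL : MemLp ((Ioc a d).indicator fun x => g x - p x) 2 (intervalMeasure a b) := by
      rw [indicator_sub]
      exact ((Lp.memLp g).indicator measurableSet_Ioc).sub hpL
    set w : L2 H a b := hwL.toLp
    have hw : w =ᵐ[intervalMeasure a b] (Ioc a d).indicator fun x => g x - p x := hwL.coeFn_toLp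
    obtain ⟨u, u₁, hu, hu0, hu1, -⟩ := hQ.exists_solution hdI 0 0 (w := w)
      fun x hx y hy => L2.intervalIntegrable w hx hy
    have huw : w =ᵐ[intervalMeasure a b] fun x => -(V x (u x) - w x) + V x (u x) :=
      ae_of_all _ fun x => by simp
    -- beyond `d` the solution `u` vanishes
    have huz : ∀ x, x ∈ halfOpenInterval a b → d ≤ x → u x = 0 := by
      intro x hx hdx
      have hJ : Icc d x ⊆ halfOpenInterval a b := ordConnected_halfOpenInterval.out hdI hx
      have hQJ : IsCoeff (Icc d x) V (fun x => ‖V x‖) :=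
        ⟨hQ.norm_le, fun c hc e he => hQ.integrable c (hJ hc) e (hJ he),
          fun h c hc e he => hQ.measurable h c (hJ hc) e (hJ he)⟩
      refine (hQJ.eq_zero (left_mem_Icc.2 hdx) (hu.mono hJ) ?_ hu0 hu1 x (right_mem_Icc.2 hdx)).1
      filter_upwards [ae_intervalMeasure_iff.1 hw,
        measure_eq_zero_iff_ae_notMem.1 (measure_singleton d : volume {d} = 0)] with t ht htd htJ
      have htd' : d < t := lt_of_le_of_ne htJ.1 (Ne.symm htd)
      rw [ht ⟨hd.1.trans htd', (hJ htJ).2⟩, indicator_of_notMem (fun h => not_le.2 htd' h.2),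
        sub_zero]
    have huL : MemLp ((openInterval a b).indicator u) 2 (intervalMeasure a b) := by
      have huc : ContinuousOn u (Icc a d) := by
        rw [← uIcc_of_le hd.1.le]; exact hu.continuousOn haI hdI
      obtain ⟨C, hC⟩ := isCompact_Icc.exists_bound_of_continuousOn huc
      refine (memLp_of_bounded (d := d) (C := C) ?_ (fun x hx => ?_) fun x hx => ?_).1
      · exact ((huc.mono Ioc_subset_Icc_self).aestronglyMeasurable measurableSet_Ioc).indicator
          measurableSet_openInterval
      · rw [indicator_of_mem (hsub hx)]; exact hC x (Ioc_subset_Icc_self hx)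
      · by_cases hxI : x ∈ openInterval a b
        · rw [indicator_of_mem hxI]; exact huz x (openInterval_subset hxI) hx.le
        · exact indicator_of_notMem hxI _
    set U : L2 H a b := huL.toLp
    have hU : U =ᵐ[intervalMeasure a b] u := by
      filter_upwards [huL.coeFn_toLp, ae_restrict_mem measurableSet_openInterval] with x hx hxI
      rw [hx, indicator_of_mem hxI]
    set q : H := cosOp α (u a) + sinOp α (u₁ a)
    set r : H := -sinOp α (u a) + cosOp α (u₁ a)
    have hmem : (U, w, q, r) ∈ boundaryTriple a b V α :=
      mem_boundaryTriple.2 ⟨u, u₁, _, hu, hU, huw, (rotate_symm_rotate hα _ _).1.symm,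
        (rotate_symm_rotate hα _ _).2.symm⟩
    have e1 : inner ℂ g (w - F q) = inner ℂ k (U - E q) := by
      refine hgk _ _ (r - 0) ?_
      convert (boundaryTriple a b V α).sub_mem hmem (hEF q) using 1
      simp
    have e2 : inner ℂ h q = inner ℂ k (E q) - inner ℂ g (F q) := by
      rw [hh, inner_sub_left, ContinuousLinearMap.adjoint_inner_left,
        ContinuousLinearMap.adjoint_inner_left]
    have e3 : inner ℂ g w = inner ℂ k U - inner ℂ h q := by
      rw [inner_sub_right, inner_sub_right] at e1
      rw [e2]
      linear_combination e1
    -- Green's identity for `p` and `u` on `[a, d]`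
    have e4 := green_compact hab hV.selfAdjoint hp hu hpk huw hdI
    rw [hu0, hu1, inner_zero_right, inner_zero_right, hp0, hp1] at e4
    have e5 : inner ℂ (-sinOp α h) (u₁ a) - inner ℂ (cosOp α h) (u a) = -inner ℂ h q := by
      simp only [q, inner_add_right, inner_neg_left, inner_cosOp, inner_sinOp]
      ring
    rw [e5, sub_self, zero_sub, neg_neg] at e4
    obtain ⟨i1, f1⟩ := L2.inner_eq k U (ae_eq_refl _) hU
    obtain ⟨i2, f2⟩ := L2.inner_eq g w (ae_eq_refl _) hw
    have hres : (intervalMeasure a b).restrict (Ioc a d) = volume.restrict (Ioc a d) :=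
      Measure.restrict_restrict_of_subset hsub
    have f3 : inner ℂ k U = ∫ t in a..d, inner ℂ (k t) (u t) := by
      rw [f1, intervalIntegral.integral_of_le hd.1.le, ← hres,
        ← integral_indicator measurableSet_Ioc]
      refine integral_congr_ae ?_
      filter_upwards [ae_restrict_mem measurableSet_openInterval] with x hx
      by_cases hxd : x ≤ d
      · rw [indicator_of_mem (show x ∈ Ioc a d from ⟨hx.1, hxd⟩)]
      · rw [indicator_of_notMem fun h => hxd h.2, huz x (openInterval_subset hx) (not_le.1 hxd).le,
          inner_zero_right]
    have hind : ∀ v : ℝ → H, (fun x => inner ℂ (v x) ((Ioc a d).indicator (fun x => g x - p x) x)) =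
        (Ioc a d).indicator fun x => inner ℂ (v x) (g x - p x) := by
      intro v
      ext x
      by_cases hx : x ∈ Ioc a d
      · rw [indicator_of_mem hx, indicator_of_mem hx]
      · rw [indicator_of_notMem hx, indicator_of_notMem hx, inner_zero_right]
    rw [hind] at i2 f2
    rw [integral_indicator measurableSet_Ioc, hres] at f2
    rw [integrable_indicator_iff measurableSet_Ioc, IntegrableOn, hres] at i2
    have j1 : IntegrableOn (fun t => inner ℂ (k t) (u t)) (Ioc a d) volume := by
      rw [IntegrableOn, ← hres]; exact i1.restrict
    have j2 : IntegrableOn (fun t => inner ℂ (p t) (w t)) (Ioc a d) volume := by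
      have := (L2.inner_eq hpL.toLp w hpL.coeFn_toLp (ae_eq_refl _)).1.restrict (s := Ioc a d)
      rw [hres] at this
      refine this.congr ((ae_restrict_iff' measurableSet_Ioc).2 (ae_of_all _ fun x hx => ?_))
      simp only
      rw [indicator_of_mem hx]
    have f4 : ∫ t in Ioc a d, inner ℂ (p t) (w t) = ∫ t in Ioc a d, inner ℂ (p t) (g t - p t) := by
      refine setIntegral_congr_ae measurableSet_Ioc ?_
      filter_upwards [ae_intervalMeasure_iff.1 hw] with x hx hxd
      rw [hx (hsub hxd), indicator_of_mem hxd]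
    have j3 : IntegrableOn (fun t => inner ℂ (p t) (g t - p t)) (Ioc a d) volume := by
      refine j2.congr_fun_ae ((ae_restrict_iff' measurableSet_Ioc).2 ?_)
      filter_upwards [ae_intervalMeasure_iff.1 hw] with x hx hxd
      rw [hx (hsub hxd), indicator_of_mem hxd]
    rw [intervalIntegral.integral_of_le hd.1.le, integral_sub j1 j2, f4,
      ← intervalIntegral.integral_of_le hd.1.le, ← f3] at e4
    -- the two Green identities combine to `∫_a^d ‖g - p‖² = 0`
    have e6 : ∫ t in Ioc a d, inner ℂ (g t - p t) (g t - p t) = 0 := by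
      have : ∫ t in Ioc a d, inner ℂ (g t - p t) (g t - p t) =
          (∫ t in Ioc a d, inner ℂ (g t) (g t - p t)) - ∫ t in Ioc a d, inner ℂ (p t) (g t - p t) := by
        rw [← integral_sub i2 j3]
        simp only [inner_sub_left]
      rw [this, ← f2, e3, e4]
      ring
    have e7 : ∫ t in Ioc a d, ‖g t - p t‖ ^ 2 = 0 := by
      have h1 : ∀ t, inner ℂ (g t - p t) (g t - p t) = ((‖g t - p t‖ ^ 2 : ℝ) : ℂ) := fun t => by
        rw [inner_self_eq_norm_sq_to_K]; push_cast; rfl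
      simp_rw [h1] at e6
      rw [integral_complex_ofReal] at e6
      exact_mod_cast e6
    have j4 : Integrable (fun t => ‖g t - p t‖ ^ 2) (volume.restrict (Ioc a d)) := by
      have := (i2.sub j3).norm
      refine this.congr (ae_of_all _ fun t => ?_)
      simp only [Pi.sub_apply]
      rw [← inner_sub_left, inner_self_eq_norm_sq_to_K]
      simp
    have e8 := (integral_eq_zero_iff_of_nonneg (fun t => by positivity) j4).1 e7
    filter_upwards [(ae_restrict_iff' measurableSet_Ioc).1 e8] with x hx hxd
    have := hx hxd
    simp only [Pi.zero_apply] at this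
    exact sub_eq_zero.1 (norm_eq_zero.1 (pow_eq_zero_iff (by norm_num)|>.1 this))
  obtain ⟨x, -, hmem, -, hun⟩ := exists_exhaustion hab
  refine ae_intervalMeasure_iff.2 ?_
  filter_upwards [ae_all_iff.2 fun n => key (x n) (hmem n)] with t ht htI
  rw [← hun] at htI
  obtain ⟨n, hn⟩ := mem_iUnion.1 htI
  exact ht n hn

/-- The boundary triple of the maximal operator, in the limit-point case. -/
lemma exists_isBoundaryTriple (hab : (a : EReal) < b) (hV : IsPotential a b V)
    (ha : IsRegularLeft a b V) (hb : IsLimitPointRight a b V) (hα : IsSelfAdjoint α) :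
    ∃ E F : H →L[ℂ] L2 H a b, IsBoundaryTriple (boundaryTriple a b V α) E F := by
  obtain ⟨E, F, hEF⟩ := exists_lift (α := α) hab hV ha
  exact ⟨E, F, fun h h' => boundaryTriple_green hab hV hb hα h h', hEF,
    boundaryTriple_maximal hab hV ha hα hEF⟩

end Lift

/-! ### Boundary values of the elements of the deficiency spaces -/

section Deficiency

variable {H : Type*} [NormedAddCommGroup H] [InnerProductSpace ℂ H] {I : Set ℝ}

lemma IsPrimitiveOn.continuousOn_of_isOpen [I.OrdConnected] (hI : IsOpen I) {Y f : ℝ → H}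
    (h : IsPrimitiveOn I Y f) : ContinuousOn Y I := by
  intro x hx
  obtain ⟨l, u, hx', hsub⟩ := mem_nhds_iff_exists_Ioo_subset.1 (hI.mem_nhds hx)
  have h1 : (l + x) / 2 ∈ I := hsub ⟨by linarith [hx'.1], by linarith [hx'.1, hx'.2]⟩
  have h2 : (x + u) / 2 ∈ I := hsub ⟨by linarith [hx'.1, hx'.2], by linarith [hx'.2]⟩
  have h3 := h.continuousOn h1 h2
  rw [uIcc_of_le (by linarith [hx'.1, hx'.2])] at h3
  exact (h3.continuousAt (Icc_mem_nhds (by linarith [hx'.1]) (by linarith [hx'.2]))).continuousWithinAt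

/-- The `C¹` representative of a class in `W^{2,1}_loc` of an open interval is unique, and so is its
derivative. -/
lemma IsW21Loc.eqOn_of_ae_eq [CompleteSpace H] [I.OrdConnected] (hI : IsOpen I)
    {y y₁ y₂ v v₁ v₂ : ℝ → H} (hy : IsW21Loc I y y₁ y₂) (hv : IsW21Loc I v v₁ v₂)
    (h : y =ᵐ[volume.restrict I] v) : EqOn y v I ∧ EqOn y₁ v₁ I := by
  obtain ⟨p, q⟩ := isW21Loc_iff.1 (hy.sub hv)
  have hD : EqOn (y - v) 0 I := by
    refine Measure.eqOn_open_of_ae_eq (μ := volume) ?_ hI (p.continuousOn_of_isOpen hI) continuousOn_const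
    filter_upwards [h] with x hx
    simp [hx]
  refine ⟨fun x hx => sub_eq_zero.1 (hD hx), fun x hx => sub_eq_zero.1 ?_⟩
  have hqc := q.continuousOn_of_isOpen hI
  have h1 : HasDerivAt (fun t => ∫ s in x..t, (y₁ - v₁) s) ((y₁ - v₁) x) x :=
    intervalIntegral.integral_hasDerivAt_right (p.integrable x hx x hx)
      (hqc.stronglyMeasurableAtFilter hI x hx) (hqc.continuousAt (hI.mem_nhds hx))
  have h2 : (fun t => ∫ s in x..t, (y₁ - v₁) s) =ᶠ[𝓝 x] fun _ => 0 := by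
    filter_upwards [hI.mem_nhds hx] with t ht
    rw [← p.sub_eq x hx t ht, hD ht, hD hx]
    simp
  exact h1.unique ((hasDerivAt_const x (0 : H)).congr_of_eventuallyEq h2)

variable {a : ℝ} {b : EReal}

lemma IsPrimitiveOn.tendsto_left (hab : (a : EReal) < b) {Y f : ℝ → H}
    (h : IsPrimitiveOn (halfOpenInterval a b) Y f) : Tendsto Y (𝓝[>] a) (𝓝 (Y a)) := by
  obtain ⟨d, hd, had⟩ := exists_mem_openInterval (left_mem hab)
  have h1 := h.continuousOn (left_mem hab) (openInterval_subset hd)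
  rw [uIcc_of_le had.le] at h1
  have h2 := (h1 a (left_mem_Icc.2 had.le)).mono (Ioc_subset_Icc_self (a := a) (b := d))
  rwa [ContinuousWithinAt, nhdsWithin_Ioc_eq_nhdsGT had] at h2

variable {V : ℝ → H →L[ℂ] H}

lemma isMaxRep_of_eigen {z : ℂ} {u : L2 H a b} {y y₁ : ℝ → H}
    (hy : IsW21Loc (halfOpenInterval a b) y y₁ (fun x => V x (y x) - z • y x))
    (hu : u =ᵐ[intervalMeasure a b] y) : IsMaxRep a b V u (z • u) y y₁ := by
  refine ⟨_, hy.mono openInterval_subset, hu, ?_⟩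
  filter_upwards [hu, Lp.coeFn_smul z u] with x h1 h2
  rw [h2, Pi.smul_apply, h1]
  abel

variable [CompleteSpace H]

lemma boundaryData_eq (hab : (a : EReal) < b) {z : ℂ} {u : L2 H a b} {y y₁ : ℝ → H}
    (hy : IsW21Loc (halfOpenInterval a b) y y₁ (fun x => V x (y x) - z • y x))
    (hu : u =ᵐ[intervalMeasure a b] y) :
    HasBoundaryData a b V u (boundaryData a b V u) ∧ boundaryData a b V u = (y a, y₁ a) := by
  have hy' := isW21Loc_iff.1 hy
  have h : HasBoundaryData a b V u (y a, y₁ a) :=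
    ⟨z • u, y, y₁, isMaxRep_of_eigen hy hu, hy'.1.tendsto_left hab, hy'.2.tendsto_left hab⟩
  have h' : HasBoundaryData a b V u (boundaryData a b V u) := Classical.epsilon_spec ⟨_, h⟩
  refine ⟨h', ?_⟩
  obtain ⟨w, v, v₁, ⟨v₂, hv, huv, -⟩, l0, l1⟩ := h'
  obtain ⟨e0, e1⟩ := (hy.mono openInterval_subset).eqOn_of_ae_eq isOpen_openInterval hv
    (hu.symm.trans huv)
  obtain ⟨d, hd, had⟩ := exists_mem_openInterval (left_mem hab)
  have hnhds : openInterval a b ∈ 𝓝[>] a :=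
    mem_of_superset (Ioc_mem_nhdsGT had) fun x hx =>
      ⟨hx.1, (EReal.coe_le_coe_iff.2 hx.2).trans_lt hd.2⟩
  refine Prod.ext (tendsto_nhds_unique l0 ((hy'.1.tendsto_left hab).congr' ?_))
    (tendsto_nhds_unique l1 ((hy'.2.tendsto_left hab).congr' ?_))
  · exact mem_of_superset hnhds e0
  · exact mem_of_superset hnhds e1

variable {α : H →L[ℂ] H}

lemma mem_deficiencySpace_of_mem_boundaryTriple (hab : (a : EReal) < b) (hα : IsSelfAdjoint α)
    {z : ℂ} {u : L2 H a b} {f g : H} (h : (u, z • u, f, g) ∈ boundaryTriple a b V α) :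
    ∃ hu : u ∈ deficiencySpace a b V z,
      boundaryMap₁ a b V α z ⟨u, hu⟩ = f ∧ boundaryMap₂ a b V α z ⟨u, hu⟩ = g ∧
      ∃ y y₁, IsW21Loc (halfOpenInterval a b) y y₁ (fun x => V x (y x) - z • y x) ∧
        u =ᵐ[intervalMeasure a b] y ∧
        y a = cosOp α f - sinOp α g ∧ y₁ a = sinOp α f + cosOp α g := by
  obtain ⟨y, y₁, y₂, hy, hu, hw, h0, h1⟩ := mem_boundaryTriple.1 h
  have hy' : IsW21Loc (halfOpenInterval a b) y y₁ (fun x => V x (y x) - z • y x) := by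
    refine hy.congr (fun _ _ => rfl) (fun _ _ => rfl) (ae_halfOpenInterval ?_)
    filter_upwards [hu, hw, Lp.coeFn_smul z u] with x e1 e2 e3
    have e4 : z • y x = -y₂ x + V x (y x) := by rw [← e2, e3, Pi.smul_apply, e1]
    rw [e4]
    abel
  obtain ⟨-, he⟩ := boundaryData_eq hab hy' hu
  have hmem : u ∈ deficiencySpace a b V z := ⟨y, y₁, isMaxRep_of_eigen hy' hu⟩
  refine ⟨hmem, ?_, ?_, y, y₁, hy', hu, h0, h1⟩
  · simp only [boundaryMap₁, he, h0, h1]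
    exact (rotate_rotate_symm hα f g).1
  · simp only [boundaryMap₂, he, h0, h1]
    exact (rotate_rotate_symm hα f g).2

variable [TopologicalSpace.SeparableSpace H]

/-- Every solution of `τ y = z y` on `(a, b)` extends to the regular end point `a`. -/
lemma exists_extension (hab : (a : EReal) < b) (hV : IsPotential a b V) (ha : IsRegularLeft a b V)
    {z : ℂ} {u : L2 H a b} (hu : u ∈ deficiencySpace a b V z) :
    ∃ y y₁ : ℝ → H, IsW21Loc (halfOpenInterval a b) y y₁ (fun x => V x (y x) - z • y x) ∧
      u =ᵐ[intervalMeasure a b] y := by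
  obtain ⟨v, v₁, v₂, hv, huv, hw⟩ := hu
  change u =ᵐ[intervalMeasure a b] v at huv
  change (z • u : L2 H a b) =ᵐ[intervalMeasure a b] fun x => -v₂ x + V x (v x) at hw
  obtain ⟨c, hc, -⟩ := exists_mem_openInterval (left_mem hab)
  have hQ := hV.isCoeff ha z
  obtain ⟨y, y₁, hy, h0, h1, -⟩ := hQ.exists_solution (openInterval_subset hc) (v c) (v₁ c) (w := 0)
    fun _ _ _ _ => intervalIntegrable_const
  have hQ' : IsCoeff (openInterval a b) (fun x => V x - z • ContinuousLinearMap.id ℂ H)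
      (fun x => ‖V x‖ + ‖z • ContinuousLinearMap.id ℂ H‖) :=
    ⟨hQ.norm_le, fun c hc d hd => hQ.integrable c (openInterval_subset hc) d
      (openInterval_subset hd), fun h c hc d hd => hQ.measurable h c (openInterval_subset hc) d
      (openInterval_subset hd)⟩
  have heq := hQ'.eq_zero hc ((hy.mono openInterval_subset).sub hv) (by
      filter_upwards [ae_intervalMeasure_iff.1 huv, ae_intervalMeasure_iff.1 hw,
        ae_intervalMeasure_iff.1 (Lp.coeFn_smul z u)] with x e1 e2 e3 hx
      have e4 : z • v x = -v₂ x + V x (v x) := by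
        rw [← e2 hx, e3 hx, Pi.smul_apply, e1 hx]
      have e5 : v₂ x = V x (v x) - z • v x := by rw [e4]; abel
      simp only [Pi.sub_apply, e5, sub_apply, smul_apply, ContinuousLinearMap.id_apply, map_sub,
        Pi.zero_apply, sub_zero]) (by simp [h0]) (by simp [h1])
  refine ⟨y, y₁, by simpa using hy, ?_⟩
  filter_upwards [huv, ae_restrict_mem measurableSet_openInterval] with x hx hxI
  rw [hx]
  exact (sub_eq_zero.1 (heq x hxI).1).symm

/-! ### The fundamental system and the Weyl–Titchmarsh function -/

lemma exists_operatorSolution (hab : (a : EReal) < b) (hV : IsPotential a b V)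
    (ha : IsRegularLeft a b V) (z : ℂ) (A B : H →L[ℂ] H) :
    ∃ Y, IsOperatorSolution a b V z A B Y := by
  obtain ⟨S, S₁, hS, hS0, -⟩ := (hV.isCoeff ha z).exists_fundamental (left_mem hab)
  refine ⟨fun x => (S x).comp (A.prod B), fun h => ⟨_, _, hS (A h, B h), ae_of_all _ fun x => ?_,
    (hS0 _).1, (hS0 _).2⟩⟩
  simp

lemma isOperatorSolution_theta (hab : (a : EReal) < b) (hV : IsPotential a b V)
    (ha : IsRegularLeft a b V) (z : ℂ) :
    IsOperatorSolution a b V z (cosOp α) (sinOp α) (theta a b V α z) :=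
  Classical.epsilon_spec (exists_operatorSolution hab hV ha z _ _)

lemma isOperatorSolution_phi (hab : (a : EReal) < b) (hV : IsPotential a b V)
    (ha : IsRegularLeft a b V) (z : ℂ) :
    IsOperatorSolution a b V z (-sinOp α) (cosOp α) (phi a b V α z) :=
  Classical.epsilon_spec (exists_operatorSolution hab hV ha z _ _)

/-- A solution of `τ y = z y` is determined by its boundary values in terms of `θ` and `φ`. -/
lemma eq_theta_add_phi (hab : (a : EReal) < b) (hV : IsPotential a b V) (ha : IsRegularLeft a b V)
    {z : ℂ} {y y₁ : ℝ → H} {f g : H}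
    (hy : IsW21Loc (halfOpenInterval a b) y y₁ (fun x => V x (y x) - z • y x))
    (h0 : y a = cosOp α f - sinOp α g) (h1 : y₁ a = sinOp α f + cosOp α g) :
    ∀ x ∈ halfOpenInterval a b, y x = theta a b V α z x f + phi a b V α z x g := by
  obtain ⟨t₁, t₂, ht, ht', t0, t1⟩ := isOperatorSolution_theta (α := α) hab hV ha z f
  obtain ⟨p₁, p₂, hp, hp', p0, p1⟩ := isOperatorSolution_phi (α := α) hab hV ha z g
  have := (hV.isCoeff ha z).eq_zero (left_mem hab) (hy.sub (ht.add hp)) (by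
    filter_upwards [ae_halfOpenInterval ht', ae_halfOpenInterval hp'] with x e1 e2 hx
    have e3 : t₂ x = V x (theta a b V α z x f) - z • theta a b V α z x f := by
      rw [← e1 hx]; abel
    have e4 : p₂ x = V x (phi a b V α z x g) - z • phi a b V α z x g := by
      rw [← e2 hx]; abel
    simp only [Pi.sub_apply, Pi.add_apply, e3, e4, sub_apply, smul_apply,
      ContinuousLinearMap.id_apply, map_sub, map_add]) (by simp [h0, t0, p0, sub_eq_add_neg]) (by simp [h1, t1, p1])
  intro x hx
  exact sub_eq_zero.1 (this x hx).1

/-- The elements of `D_z` and their boundary values, in terms of the boundary triple. -/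
lemma mem_boundaryTriple_of_mem_deficiencySpace (hab : (a : EReal) < b) (hV : IsPotential a b V)
    (ha : IsRegularLeft a b V) (hα : IsSelfAdjoint α) {z : ℂ} (u : deficiencySpace a b V z) :
    HasBoundaryData a b V u (boundaryData a b V u) ∧
    ((u : L2 H a b), z • (u : L2 H a b), boundaryMap₁ a b V α z u, boundaryMap₂ a b V α z u) ∈
      boundaryTriple a b V α := by
  obtain ⟨y, y₁, hy, hu⟩ := exists_extension hab hV ha u.2
  obtain ⟨hd, he⟩ := boundaryData_eq hab hy hu
  refine ⟨hd, mem_boundaryTriple.2 ⟨y, y₁, _, hy, hu, ?_, ?_, ?_⟩⟩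
  · filter_upwards [hu, Lp.coeFn_smul z (u : L2 H a b)] with x h1 h2
    rw [h2, Pi.smul_apply, h1]
    abel
  · rw [boundaryMap₁, boundaryMap₂, he]
    exact (rotate_symm_rotate hα _ _).1.symm
  · rw [boundaryMap₁, boundaryMap₂, he]
    exact (rotate_symm_rotate hα _ _).2.symm

end Deficiency

end WeylTitchmarsh

theorem theorem3p15 {H : Type*} [NormedAddCommGroup H] [InnerProductSpace ℂ H] [CompleteSpace H]
    [TopologicalSpace.SeparableSpace H] (a : ℝ) (b : EReal) (hab : (a : EReal) < b)
    (V : ℝ → H →L[ℂ] H) (hV : WeylTitchmarsh.IsPotential a b V)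
    (ha : WeylTitchmarsh.IsRegularLeft a b V) (hb : WeylTitchmarsh.IsLimitPointRight a b V)
    (α : H →L[ℂ] H) (hα : IsSelfAdjoint α) :
    (∀ z : ℂ, z.im ≠ 0 →
      -- the fundamental system `θ`, `φ` is well defined
      WeylTitchmarsh.IsOperatorSolution a b V z (WeylTitchmarsh.cosOp α) (WeylTitchmarsh.sinOp α)
        (WeylTitchmarsh.theta a b V α z) ∧
      WeylTitchmarsh.IsOperatorSolution a b V z (-WeylTitchmarsh.sinOp α) (WeylTitchmarsh.cosOp α)
        (WeylTitchmarsh.phi a b V α z) ∧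
      -- every `u ∈ D_z` is `θ f + φ g` with `f`, `g` its images under the boundary-data maps
      (∀ u : WeylTitchmarsh.deficiencySpace a b V z,
        WeylTitchmarsh.HasBoundaryData a b V u (WeylTitchmarsh.boundaryData a b V u) ∧
        (u : WeylTitchmarsh.L2 H a b) =ᵐ[WeylTitchmarsh.intervalMeasure a b] fun x =>
          WeylTitchmarsh.theta a b V α z x (WeylTitchmarsh.boundaryMap₁ a b V α z u) +
            WeylTitchmarsh.phi a b V α z x (WeylTitchmarsh.boundaryMap₂ a b V α z u)) ∧
      -- so that the inverse in the definition of `m_α(z)` exists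
      Function.Bijective (WeylTitchmarsh.boundaryMap₁ a b V α z)) ∧
    -- `m_α(z)` is a bounded operator, analytic in `z`, with `m_α(z) = m_α(z̄)*`
    (∃ M : ℂ → H →L[ℂ] H,
      (∀ z : ℂ, z.im ≠ 0 → ⇑(M z) = WeylTitchmarsh.weylM a b V α z) ∧
      AnalyticOnNhd ℂ M {z : ℂ | z.im ≠ 0} ∧
      ∀ z : ℂ, z.im ≠ 0 →
        M z = ContinuousLinearMap.adjoint (M ((starRingEnd ℂ) z))) ∧
    -- the Weyl–Titchmarsh solution is square integrable
    (∀ z : ℂ, z.im ≠ 0 → ∀ h : H,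
      MeasureTheory.MemLp (fun x => WeylTitchmarsh.weylSolution a b V α z x h) 2
        (WeylTitchmarsh.intervalMeasure a b)) := by
  open WeylTitchmarsh in
  obtain ⟨E, F, hΓ⟩ := exists_isBoundaryTriple hab hV ha hb hα
  obtain ⟨M, hM, hMan, hMadj⟩ := hΓ.exists_weylFunction
  have hrep : ∀ z : ℂ, ∀ u : deficiencySpace a b V z,
      (u : L2 H a b) =ᵐ[intervalMeasure a b] fun x =>
        theta a b V α z x (boundaryMap₁ a b V α z u) +
          phi a b V α z x (boundaryMap₂ a b V α z u) := by
    intro z u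
    obtain ⟨-, hmem⟩ := mem_boundaryTriple_of_mem_deficiencySpace hab hV ha hα u
    obtain ⟨-, -, -, y, y₁, hy, hu, h0, h1⟩ := mem_deficiencySpace_of_mem_boundaryTriple hab hα hmem
    filter_upwards [hu, ae_restrict_mem measurableSet_openInterval] with x hx hxI
    rw [hx]
    exact eq_theta_add_phi hab hV ha hy h0 h1 x (openInterval_subset hxI)
  have hinj : ∀ z : ℂ, z.im ≠ 0 → Function.Injective (boundaryMap₁ a b V α z) := by
    intro z hz u v huv
    have h1 := (mem_boundaryTriple_of_mem_deficiencySpace hab hV ha hα u).2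
    have h2 := (mem_boundaryTriple_of_mem_deficiencySpace hab hV ha hα v).2
    refine Subtype.ext (sub_eq_zero.1 (hΓ.eq_zero hz
      (q := boundaryMap₂ a b V α z u - boundaryMap₂ a b V α z v) ?_))
    convert (boundaryTriple a b V α).sub_mem h1 h2 using 1
    simp [huv, smul_sub]
  have hsurj : ∀ z : ℂ, z.im ≠ 0 → ∀ h, ∃ u, boundaryMap₁ a b V α z u = h ∧
      boundaryMap₂ a b V α z u = M z h := by
    intro z hz h
    obtain ⟨u, hu⟩ := hM z hz h
    obtain ⟨hmem, h1, h2, -⟩ := mem_deficiencySpace_of_mem_boundaryTriple hab hα hu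
    exact ⟨⟨u, hmem⟩, h1, h2⟩
  have hweyl : ∀ z : ℂ, z.im ≠ 0 → ∀ h, weylM a b V α z h = M z h := by
    intro z hz h
    obtain ⟨u, h1, h2⟩ := hsurj z hz h
    rw [weylM, ← h1, Function.leftInverse_invFun (hinj z hz) u, h2, h1]
  refine ⟨fun z hz => ⟨isOperatorSolution_theta hab hV ha z, isOperatorSolution_phi hab hV ha z,
    fun u => ⟨(mem_boundaryTriple_of_mem_deficiencySpace hab hV ha hα u).1, hrep z u⟩,
    hinj z hz, fun h => (hsurj z hz h).imp fun u hu => hu.1⟩,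
    ⟨M, fun z hz => funext fun h => (hweyl z hz h).symm, hMan, hMadj⟩, fun z hz h => ?_⟩
  obtain ⟨u, h1, h2⟩ := hsurj z hz h
  refine (memLp_congr_ae ?_).1 (Lp.memLp (u : L2 H a b))
  filter_upwards [hrep z u] with x hx
  rw [hx, weylSolution, hweyl z hz, h1, h2]
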